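/- Let $(M,g)$ be a compact (Hausdorff, without boundary) $n$-dimensional smooth pseudo-Riemannian manifold, with Levi-Civita connection $\nabla^g$ and volume measure $\mu_g$, and put $\mathrm{vol}(M)=\mu_g(M)$. Let $f$ be a smooth function on $M$ such that $|\mathrm{grad} f|_g^2:=g(\mathrm{grad} f,\mathrm{grad} f)$ is constant, and let $$\nabla^{df}=\nabla^g+df\otimes I+I\otimes df+g\otimes \mathrm{grad} f .$$ For an affine connection $\nabla$ write $\mathrm{Hess}^\nabla(f)(X,Y)=g(\nabla_X\mathrm{grad} f,Y)$, $\Delta^\nabla(f)=\mathrm{tr}(X\mapsto\nabla_X\mathrm{grad} f)$, $R^\nabla(X,Y)=[\nabla_X,\nabla_Y]-\nabla_{[X,Y]}$ and $\mathrm{Ric}^\nabla(Y,Z)=\mathrm{tr}(X\mapsto R^\nabla(X,Y)Z)$, with superscript $g$ for $\nabla=\nabla^g$ and $df$ for $\nabla=\nabla^{df}$. Let $\langle T,S\rangle_g=g^{ik}g^{jl}T_{ij}S_{kl}$ and $|T|_g^2=\langle T,T\rangle_g$ for covariant 2-tensors. Then $\mathrm{vol}(M)$ is finite, all the integrals below converge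 absolutely, and $$2(n-1)\,|\mathrm{grad} f|_g^4\,\mathrm{vol}(M)=\int_M|\mathrm{Hess}^g(f)|_g^2\,d\mu_g+\int_M \mathrm{grad} f(\Delta^g(f))\,d\mu_g+\int_M\langle \mathrm{Ric}^{df},df\otimes df\rangle_g\,d\mu_g ,$$ $$3(n+2)\,|\mathrm{grad} f|_g^4\,\mathrm{vol}(M)=\int_M|\mathrm{Hess}^{df}(f)|_g^2\,d\mu_g+\int_M \mathrm{grad} f(\Delta^{df}(f))\,d\mu_g+\int_M\mathrm{Ric}^{df}(\mathrm{grad} f,\mathrm{grad} f)\,d\mu_g .$$ In particular, whenever $|\mathrm{grad} f|_g^2\neq0$ (and $n\neq 1$ in the first case), $\mathrm{vol}(M)$ equals $\frac{1}{2(n-1)|\mathrm{grad} f|_g^4}$ times the first right-hand side, respectively $\frac{1}{3(n+2)|\mathrm{grad} f|_g^4}$ times the second. -/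

import Mathlib

open scoped Manifold ContDiff Topology Bundle
open MeasureTheory

noncomputable section

/-- A smooth pseudo-Riemannian metric on an `n`-dimensional smooth manifold (without boundary):
a smooth field of nondegenerate symmetric bilinear forms on the tangent spaces. -/
structure PseudoRiemannianMetric (n : ℕ) (M : Type*) [TopologicalSpace M]
    [ChartedSpace (EuclideanSpace ℝ (Fin n)) M] [IsManifold (𝓡 n) ∞ M] where
  /-- The scalar product `g_x(v, w)`. -/
  inner (x : M) : TangentSpace (𝓡 n) x →L[ℝ] TangentSpace (𝓡 n) x →L[ℝ] ℝ
  symm (x : M) (v w : TangentSpace (𝓡 n) x) : inner x v w = inner x w v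
  nondegenerate (x : M) (v : TangentSpace (𝓡 n) x) : (∀ w, inner x v w = 0) → v = 0
  contMDiff : ContMDiff (𝓡 n) ((𝓡 n).prod 𝓘(ℝ, EuclideanSpace ℝ (Fin n) →L[ℝ] EuclideanSpace ℝ (Fin n) →L[ℝ] ℝ)) ∞
    (fun x ↦ Bundle.TotalSpace.mk' (EuclideanSpace ℝ (Fin n) →L[ℝ] EuclideanSpace ℝ (Fin n) →L[ℝ] ℝ)
      (E := fun x : M ↦ TangentSpace (𝓡 n) x →L[ℝ] TangentSpace (𝓡 n) x →L[ℝ] ℝ)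
      x (inner x))

namespace PseudoRiemannianMetric

variable {n : ℕ} {M : Type*} [TopologicalSpace M] [ChartedSpace (EuclideanSpace ℝ (Fin n)) M]
  [IsManifold (𝓡 n) ∞ M]

instance (x : M) : FiniteDimensional ℝ (TangentSpace (𝓡 n) x) :=
  inferInstanceAs (FiniteDimensional ℝ (EuclideanSpace ℝ (Fin n)))

instance (x : M) : T2Space (TangentSpace (𝓡 n) x) :=
  inferInstanceAs (T2Space (EuclideanSpace ℝ (Fin n)))

/-! ### Musical isomorphism and gradient -/

/-- `g_x` as a bilinear form. -/
def bilin (g : PseudoRiemannianMetric n M) (x : M) :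
    LinearMap.BilinForm ℝ (TangentSpace (𝓡 n) x) :=
  LinearMap.mk₂ ℝ (fun v w ↦ g.inner x v w) (by simp) (by simp) (by simp) (by simp)

theorem bilin_nondegenerate (g : PseudoRiemannianMetric n M) (x : M) :
    (g.bilin x).Nondegenerate :=
  ⟨fun v hv ↦ g.nondegenerate x v hv,
   fun v hv ↦ g.nondegenerate x v fun w ↦ by rw [g.symm]; exact hv w⟩

/-- The vector `α^♯` dual to a covector `α` at `x`, i.e. `g_x(α^♯, w) = α(w)` for all `w`. -/
def sharp (g : PseudoRiemannianMetric n M) (x : M) :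
    (TangentSpace (𝓡 n) x →L[ℝ] ℝ) →ₗ[ℝ] TangentSpace (𝓡 n) x :=
  ((g.bilin x).toDual (g.bilin_nondegenerate x)).symm.toLinearMap ∘ₗ
    ContinuousLinearMap.coeLM ℝ

@[simp]
theorem inner_sharp (g : PseudoRiemannianMetric n M) (x : M)
    (α : TangentSpace (𝓡 n) x →L[ℝ] ℝ) (w : TangentSpace (𝓡 n) x) :
    g.inner x (g.sharp x α) w = α w :=
  LinearMap.BilinForm.apply_toDual_symm_apply (hB := g.bilin_nondegenerate x)
    (f := (α : TangentSpace (𝓡 n) x →ₗ[ℝ] ℝ)) (v := w)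

theorem ext_inner (g : PseudoRiemannianMetric n M) {x : M} {v v' : TangentSpace (𝓡 n) x}
    (h : ∀ w, g.inner x v w = g.inner x v' w) : v = v' :=
  sub_eq_zero.1 (g.nondegenerate x _ fun w ↦ by simp [h w])

/-- The gradient of `f`: the vector field `g`-dual to `df`. -/
def grad (g : PseudoRiemannianMetric n M) (f : M → ℝ) (x : M) : TangentSpace (𝓡 n) x :=
  g.sharp x (mvfderiv (𝓡 n) f x)

/-! ### The Levi-Civita connection, via Koszul's formula -/

/-- The vector field `X` is differentiable at `x`. -/
abbrev DiffAt (X : Π x : M, TangentSpace (𝓡 n) x) (x : M) : Prop :=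
  MDifferentiableAt (𝓡 n) ((𝓡 n).prod 𝓘(ℝ, EuclideanSpace ℝ (Fin n)))
    (fun y ↦ Bundle.TotalSpace.mk' (EuclideanSpace ℝ (Fin n)) y (X y)) x

/-- The right-hand side of Koszul's formula for `2 g(∇_X Y, Z)` at `x`. -/
def koszul (g : PseudoRiemannianMetric n M) (X Y Z : Π x : M, TangentSpace (𝓡 n) x) (x : M) : ℝ :=
  mvfderiv (𝓡 n) (fun y ↦ g.inner y (Y y) (Z y)) x (X x) + mvfderiv (𝓡 n) (fun y ↦ g.inner y (X y) (Z y)) x (Y x)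
    - mvfderiv (𝓡 n) (fun y ↦ g.inner y (X y) (Y y)) x (Z x)
    + g.inner x (VectorField.mlieBracket (𝓡 n) X Y x) (Z x)
    - g.inner x (VectorField.mlieBracket (𝓡 n) X Z x) (Y x)
    - g.inner x (VectorField.mlieBracket (𝓡 n) Y Z x) (X x)

theorem mdifferentiableAt_inner (g : PseudoRiemannianMetric n M)
    {X Y : Π x : M, TangentSpace (𝓡 n) x} {x : M}
    (hX : DiffAt X x) (hY : DiffAt Y x) :
    MDifferentiableAt (𝓡 n) 𝓘(ℝ, ℝ) (fun y ↦ g.inner y (X y) (Y y)) x := by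
  have hg := (g.contMDiff x).mdifferentiableAt (by simp)
  have := MDifferentiableAt.clm_bundle_apply₂ (F₁ := EuclideanSpace ℝ (Fin n)) (F₂ := EuclideanSpace ℝ (Fin n)) (F₃ := ℝ)
    (E₃ := Bundle.Trivial M ℝ) (b := id) hg hX hY
  simp only [mdifferentiableAt_totalSpace] at this
  exact this.2

theorem koszul_add_left (g : PseudoRiemannianMetric n M)
    {X X' Y Z : Π x : M, TangentSpace (𝓡 n) x} {x : M}
    (hX : DiffAt X x) (hX' : DiffAt X' x) (hY : DiffAt Y x) (hZ : DiffAt Z x) :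
    g.koszul (X + X') Y Z x = g.koszul X Y Z x + g.koszul X' Y Z x := by
  have h1 : (fun y ↦ g.inner y ((X + X') y) (Z y)) =
      (fun y ↦ g.inner y (X y) (Z y)) + fun y ↦ g.inner y (X' y) (Z y) := by ext; simp
  have h2 : (fun y ↦ g.inner y ((X + X') y) (Y y)) =
      (fun y ↦ g.inner y (X y) (Y y)) + fun y ↦ g.inner y (X' y) (Y y) := by ext; simp
  simp only [koszul]
  rw [h1, h2, mvfderiv_add (g.mdifferentiableAt_inner hX hZ) (g.mdifferentiableAt_inner hX' hZ),
    mvfderiv_add (g.mdifferentiableAt_inner hX hY) (g.mdifferentiableAt_inner hX' hY),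
    VectorField.mlieBracket_add_left hX hX', VectorField.mlieBracket_add_left hX hX']
  simp
  ring

theorem koszul_smul_left (g : PseudoRiemannianMetric n M)
    {X Y Z : Π x : M, TangentSpace (𝓡 n) x} {a : M → ℝ} {x : M}
    (ha : MDifferentiableAt (𝓡 n) 𝓘(ℝ, ℝ) a x)
    (hX : DiffAt X x) (hY : DiffAt Y x) (hZ : DiffAt Z x) :
    g.koszul (a • X) Y Z x = a x * g.koszul X Y Z x := by
  have h1 : (fun y ↦ g.inner y ((a • X) y) (Z y)) =
      a * fun y ↦ g.inner y (X y) (Z y) := by ext; simp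
  have h2 : (fun y ↦ g.inner y ((a • X) y) (Y y)) =
      a * fun y ↦ g.inner y (X y) (Y y) := by ext; simp
  simp only [koszul]
  rw [h1, h2, mvfderiv_mul ha (g.mdifferentiableAt_inner hX hZ),
    mvfderiv_mul ha (g.mdifferentiableAt_inner hX hY),
    VectorField.mlieBracket_smul_left ha hX, VectorField.mlieBracket_smul_left ha hX]
  simp
  ring

theorem koszul_add_right (g : PseudoRiemannianMetric n M)
    {X Y Z Z' : Π x : M, TangentSpace (𝓡 n) x} {x : M}
    (hX : DiffAt X x) (hY : DiffAt Y x) (hZ : DiffAt Z x) (hZ' : DiffAt Z' x) :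
    g.koszul X Y (Z + Z') x = g.koszul X Y Z x + g.koszul X Y Z' x := by
  have h1 : (fun y ↦ g.inner y (Y y) ((Z + Z') y)) =
      (fun y ↦ g.inner y (Y y) (Z y)) + fun y ↦ g.inner y (Y y) (Z' y) := by ext; simp
  have h2 : (fun y ↦ g.inner y (X y) ((Z + Z') y)) =
      (fun y ↦ g.inner y (X y) (Z y)) + fun y ↦ g.inner y (X y) (Z' y) := by ext; simp
  simp only [koszul]
  rw [h1, h2, mvfderiv_add (g.mdifferentiableAt_inner hY hZ) (g.mdifferentiableAt_inner hY hZ'),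
    mvfderiv_add (g.mdifferentiableAt_inner hX hZ) (g.mdifferentiableAt_inner hX hZ'),
    VectorField.mlieBracket_add_right hZ hZ', VectorField.mlieBracket_add_right hZ hZ']
  simp
  ring

theorem koszul_smul_right (g : PseudoRiemannianMetric n M)
    {X Y Z : Π x : M, TangentSpace (𝓡 n) x} {a : M → ℝ} {x : M}
    (ha : MDifferentiableAt (𝓡 n) 𝓘(ℝ, ℝ) a x)
    (hX : DiffAt X x) (hY : DiffAt Y x) (hZ : DiffAt Z x) :
    g.koszul X Y (a • Z) x = a x * g.koszul X Y Z x := by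
  have h1 : (fun y ↦ g.inner y (Y y) ((a • Z) y)) =
      a * fun y ↦ g.inner y (Y y) (Z y) := by ext; simp
  have h2 : (fun y ↦ g.inner y (X y) ((a • Z) y)) =
      a * fun y ↦ g.inner y (X y) (Z y) := by ext; simp
  simp only [koszul]
  rw [h1, h2, mvfderiv_mul ha (g.mdifferentiableAt_inner hY hZ),
    mvfderiv_mul ha (g.mdifferentiableAt_inner hX hZ),
    VectorField.mlieBracket_smul_right ha hZ, VectorField.mlieBracket_smul_right ha hZ]
  simp
  rw [g.symm x (Z x) (Y x), g.symm x (Z x) (X x)]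
  ring

theorem koszul_add_middle (g : PseudoRiemannianMetric n M)
    {X Y Y' Z : Π x : M, TangentSpace (𝓡 n) x} {x : M}
    (hX : DiffAt X x) (hY : DiffAt Y x) (hY' : DiffAt Y' x) (hZ : DiffAt Z x) :
    g.koszul X (Y + Y') Z x = g.koszul X Y Z x + g.koszul X Y' Z x := by
  have h1 : (fun y ↦ g.inner y ((Y + Y') y) (Z y)) =
      (fun y ↦ g.inner y (Y y) (Z y)) + fun y ↦ g.inner y (Y' y) (Z y) := by ext; simp
  have h2 : (fun y ↦ g.inner y (X y) ((Y + Y') y)) =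
      (fun y ↦ g.inner y (X y) (Y y)) + fun y ↦ g.inner y (X y) (Y' y) := by ext; simp
  simp only [koszul]
  rw [h1, h2, mvfderiv_add (g.mdifferentiableAt_inner hY hZ) (g.mdifferentiableAt_inner hY' hZ),
    mvfderiv_add (g.mdifferentiableAt_inner hX hY) (g.mdifferentiableAt_inner hX hY'),
    VectorField.mlieBracket_add_right hY hY', VectorField.mlieBracket_add_left hY hY']
  simp
  ring

theorem koszul_smul_middle (g : PseudoRiemannianMetric n M)
    {X Y Z : Π x : M, TangentSpace (𝓡 n) x} {a : M → ℝ} {x : M}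
    (ha : MDifferentiableAt (𝓡 n) 𝓘(ℝ, ℝ) a x)
    (hX : DiffAt X x) (hY : DiffAt Y x) (hZ : DiffAt Z x) :
    g.koszul X (a • Y) Z x =
      a x * g.koszul X Y Z x + 2 * (mvfderiv (𝓡 n) a x (X x) * g.inner x (Y x) (Z x)) := by
  have h1 : (fun y ↦ g.inner y ((a • Y) y) (Z y)) =
      a * fun y ↦ g.inner y (Y y) (Z y) := by ext; simp
  have h2 : (fun y ↦ g.inner y (X y) ((a • Y) y)) =
      a * fun y ↦ g.inner y (X y) (Y y) := by ext; simp
  simp only [koszul]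
  rw [h1, h2, mvfderiv_mul ha (g.mdifferentiableAt_inner hY hZ),
    mvfderiv_mul ha (g.mdifferentiableAt_inner hX hY),
    VectorField.mlieBracket_smul_right ha hY, VectorField.mlieBracket_smul_left ha hY]
  simp
  rw [g.symm x (Y x) (X x)]
  ring

/-- For `Y` differentiable at `x`, the bilinear form `(v, z) ↦ 2 g(∇_v Y, z)` on `T_x M`. -/
def koszulForm (g : PseudoRiemannianMetric n M) (Y : Π x : M, TangentSpace (𝓡 n) x) (x : M)
    (hY : DiffAt Y x) :
    TangentSpace (𝓡 n) x →L[ℝ] TangentSpace (𝓡 n) x →L[ℝ] ℝ :=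
  TensorialAt.mkHom₂ (I := 𝓡 n) (F := EuclideanSpace ℝ (Fin n)) (F' := EuclideanSpace ℝ (Fin n))
    (fun X Z ↦ g.koszul X Y Z x) x
    (fun _ hZ ↦ ⟨fun ha hX ↦ g.koszul_smul_left ha hX hY hZ,
      fun hX hX' ↦ g.koszul_add_left hX hX' hY hZ⟩)
    (fun _ hX ↦ ⟨fun ha hZ ↦ g.koszul_smul_right ha hX hY hZ,
      fun hZ hZ' ↦ g.koszul_add_right hX hY hZ hZ'⟩)

theorem koszulForm_apply (g : PseudoRiemannianMetric n M)
    {X Y Z : Π x : M, TangentSpace (𝓡 n) x} {x : M}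
    (hX : DiffAt X x) (hY : DiffAt Y x) (hZ : DiffAt Z x) :
    g.koszulForm Y x hY (X x) (Z x) = g.koszul X Y Z x :=
  TensorialAt.mkHom₂_apply (I := 𝓡 n) (F := EuclideanSpace ℝ (Fin n))
    (F' := EuclideanSpace ℝ (Fin n)) _ _ hX hZ

open Classical in
/-- The function underlying the Levi-Civita connection: `leviCivitaFun Y x v = (∇_v Y)(x)` is the
vector with `2 g(∇_v Y, z) = koszul X Y Z x` for any fields `X`, `Z` extending `v`, `z`. (The value
at fields that are not differentiable at `x` is irrelevant, and set to `0`.) -/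
def leviCivitaFun (g : PseudoRiemannianMetric n M) (Y : Π x : M, TangentSpace (𝓡 n) x) (x : M) :
    TangentSpace (𝓡 n) x →L[ℝ] TangentSpace (𝓡 n) x :=
  if hY : DiffAt Y x then
    LinearMap.toContinuousLinearMap
      (g.sharp x ∘ₗ ((1 / 2 : ℝ) • g.koszulForm Y x hY).toLinearMap)
  else 0

/-- Koszul's formula. -/
theorem inner_leviCivitaFun (g : PseudoRiemannianMetric n M)
    {X Y Z : Π x : M, TangentSpace (𝓡 n) x} {x : M}
    (hX : DiffAt X x) (hY : DiffAt Y x) (hZ : DiffAt Z x) :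
    g.inner x (g.leviCivitaFun Y x (X x)) (Z x) = 1 / 2 * g.koszul X Y Z x := by
  rw [← g.koszulForm_apply hX hY hZ]
  simp [leviCivitaFun, hY]

theorem leviCivitaFun_ext (g : PseudoRiemannianMetric n M) {x : M}
    {Y : Π x : M, TangentSpace (𝓡 n) x} (hY : DiffAt Y x)
    {L : TangentSpace (𝓡 n) x →L[ℝ] TangentSpace (𝓡 n) x}
    (h : ∀ X Z : Π x : M, TangentSpace (𝓡 n) x, DiffAt X x → DiffAt Z x →
      1 / 2 * g.koszul X Y Z x = g.inner x (L (X x)) (Z x)) :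
    g.leviCivitaFun Y x = L := by
  ext1 v
  refine g.ext_inner fun w ↦ ?_
  have hX := FiberBundle.mdifferentiableAt_extend (𝓡 n) (EuclideanSpace ℝ (Fin n)) v
  have hZ := FiberBundle.mdifferentiableAt_extend (𝓡 n) (EuclideanSpace ℝ (Fin n)) w
  have := (g.inner_leviCivitaFun hX hY hZ).trans (h _ _ hX hZ)
  simpa using this

theorem isCovariantDerivativeOn_leviCivitaFun (g : PseudoRiemannianMetric n M) :
    IsCovariantDerivativeOn (I := 𝓡 n) (EuclideanSpace ℝ (Fin n))
      (V := (TangentSpace (𝓡 n) : M → Type _)) g.leviCivitaFun Set.univ where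
  add {Y Y' x} hY hY' _ := by
    refine g.leviCivitaFun_ext (mdifferentiableAt_add_section hY hY') fun X Z hX hZ ↦ ?_
    rw [g.koszul_add_middle hX hY hY' hZ]
    simp [g.inner_leviCivitaFun hX hY hZ, g.inner_leviCivitaFun hX hY' hZ]
    ring
  leibniz {Y a x} hY ha _ := by
    refine g.leviCivitaFun_ext (ha.smul_section hY) fun X Z hX hZ ↦ ?_
    rw [g.koszul_smul_middle ha hX hY hZ]
    simp [g.inner_leviCivitaFun hX hY hZ]
    ring

/-- The Levi-Civita connection `∇^g`. -/
def leviCivita (g : PseudoRiemannianMetric n M) :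
    CovariantDerivative (𝓡 n) (EuclideanSpace ℝ (Fin n)) (TangentSpace (𝓡 n) : M → Type _) :=
  ⟨g.leviCivitaFun, g.isCovariantDerivativeOn_leviCivitaFun⟩

/-! ### Affine connections: Hessian, divergence, Laplacian, Ricci tensor -/

/-- An affine connection: a covariant derivative on the tangent bundle. `D Y x v` is
`(∇_v Y)(x)`. -/
abbrev AffineConnection (n : ℕ) (M : Type*) [TopologicalSpace M]
    [ChartedSpace (EuclideanSpace ℝ (Fin n)) M] [IsManifold (𝓡 n) ∞ M] : Type _ :=
  CovariantDerivative (𝓡 n) (EuclideanSpace ℝ (Fin n)) (TangentSpace (𝓡 n) : M → Type _)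

/-- The tensor `η ⊗ I + I ⊗ η + g ⊗ ξ`, with `ξ` the vector field `g`-dual to the 1-form `η`. -/
def etaTensor (g : PseudoRiemannianMetric n M) (η : Π x : M, TangentSpace (𝓡 n) x →L[ℝ] ℝ)
    (x : M) : TangentSpace (𝓡 n) x →L[ℝ] TangentSpace (𝓡 n) x →L[ℝ] TangentSpace (𝓡 n) x :=
  LinearMap.toContinuousBilinearMap <| LinearMap.mk₂ ℝ
    (fun w v ↦ η x v • w + η x w • v + g.inner x v w • g.sharp x (η x))
    (by intros; simp; module) (by intros; simp; module)
    (by intros; simp; module) (by intros; simp; module)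

/-- The affine connection `∇^η = ∇^g + η ⊗ I + I ⊗ η + g ⊗ ξ`. -/
def etaConnection (g : PseudoRiemannianMetric n M)
    (η : Π x : M, TangentSpace (𝓡 n) x →L[ℝ] ℝ) : AffineConnection n M :=
  g.leviCivita.addOneForm (g.etaTensor η)

/-- The connection `∇^{df}`. -/
def dfConnection (g : PseudoRiemannianMetric n M) (f : M → ℝ) : AffineConnection n M :=
  g.etaConnection (mvfderiv (𝓡 n) f)

/-- The Hessian `Hess^∇(f)(u, v) = g(∇_u grad f, v)`. -/
def hess (g : PseudoRiemannianMetric n M) (D : AffineConnection n M) (f : M → ℝ) (x : M)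
    (u v : TangentSpace (𝓡 n) x) : ℝ :=
  g.inner x (D (g.grad f) x u) v

/-- The divergence `div^∇(X) = tr (v ↦ ∇_v X)`. -/
def divergence (D : AffineConnection n M) (X : Π x : M, TangentSpace (𝓡 n) x) (x : M) : ℝ :=
  LinearMap.trace ℝ (TangentSpace (𝓡 n) x) (D X x).toLinearMap

/-- The Laplacian `Δ^∇(f) = div^∇(grad f)`. -/
def laplacian (g : PseudoRiemannianMetric n M) (D : AffineConnection n M) (f : M → ℝ) (x : M) :
    ℝ :=
  divergence D (g.grad f) x

/-- The curvature `R(u, v)w = ∇_U ∇_V W - ∇_V ∇_U W - ∇_{[U, V]} W` at `x`, computed with the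
extensions `U`, `V`, `W` of `u`, `v`, `w` that are constant in the trivialization of the tangent
bundle at `x` (for a smooth connection the result does not depend on the extensions). -/
def curvature (D : AffineConnection n M) (x : M) (u v w : TangentSpace (𝓡 n) x) :
    TangentSpace (𝓡 n) x :=
  let U : Π y : M, TangentSpace (𝓡 n) y := FiberBundle.extend (EuclideanSpace ℝ (Fin n)) u
  let V : Π y : M, TangentSpace (𝓡 n) y := FiberBundle.extend (EuclideanSpace ℝ (Fin n)) v
  let W : Π y : M, TangentSpace (𝓡 n) y := FiberBundle.extend (EuclideanSpace ℝ (Fin n)) w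
  D (fun y ↦ D W y (V y)) x u - D (fun y ↦ D W y (U y)) x v
    - D W x (VectorField.mlieBracket (𝓡 n) U V x)

/-- A basis of `T_x M`, used to write out traces. -/
def tangentBasis (x : M) : Module.Basis (Fin n) ℝ (TangentSpace (𝓡 n) x) :=
  (EuclideanSpace.basisFun (Fin n) ℝ).toBasis

/-- The Ricci tensor `Ric^∇(v, w) = tr (u ↦ R^∇(u, v)w)`. -/
def ricci (D : AffineConnection n M) (x : M) (v w : TangentSpace (𝓡 n) x) : ℝ :=
  ∑ i, (tangentBasis x).repr (curvature D x (tangentBasis x i) v w) i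

/-! ### Scalar product of covariant 2-tensors -/

/-- The Gram matrix `(g_{ij})` of the basis `tangentBasis x`. -/
def gram (g : PseudoRiemannianMetric n M) (x : M) : Matrix (Fin n) (Fin n) ℝ :=
  Matrix.of fun i j ↦ g.inner x (tangentBasis x i) (tangentBasis x j)

/-- The scalar product `⟨T, S⟩_g = g^{ik} g^{jl} T_{ij} S_{kl}` of two covariant 2-tensors. -/
def innerTensor (g : PseudoRiemannianMetric n M) (x : M)
    (T S : TangentSpace (𝓡 n) x → TangentSpace (𝓡 n) x → ℝ) : ℝ :=
  ∑ i, ∑ j, ∑ k, ∑ l, (g.gram x)⁻¹ i k * (g.gram x)⁻¹ j l *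
    T (tangentBasis x i) (tangentBasis x j) * S (tangentBasis x k) (tangentBasis x l)

/-! ### The volume measure -/

/-- The density `√|det(g_{ij})|` of the volume measure in the chart at `x`, at the point `y` of the
target of the chart, where `g_{ij} = g(∂_i, ∂_j)` for the coordinate vector fields `∂_i`. -/
def chartDensity (g : PseudoRiemannianMetric n M) (x : M) (y : EuclideanSpace ℝ (Fin n)) : ℝ :=
  Real.sqrt |Matrix.det (Matrix.of fun i j : Fin n ↦
    g.inner ((extChartAt (𝓡 n) x).symm y)
      (mfderiv (𝓡 n) (𝓡 n) (extChartAt (𝓡 n) x).symm y (EuclideanSpace.basisFun (Fin n) ℝ i))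
      (mfderiv (𝓡 n) (𝓡 n) (extChartAt (𝓡 n) x).symm y (EuclideanSpace.basisFun (Fin n) ℝ j)))|

/-- The volume measure `√|det(g_{ij})| dy¹⋯dyⁿ` of the domain of the chart at `x`, as a measure
on `M`. -/
def chartVolume [MeasurableSpace M] [BorelSpace M] (g : PseudoRiemannianMetric n M) (x : M) :
    Measure M :=
  Measure.map (extChartAt (𝓡 n) x).symm
    ((volume.restrict (extChartAt (𝓡 n) x).target).withDensity
      fun y ↦ ENNReal.ofReal (g.chartDensity x y))

/-- The volume measure `μ_g`. The measures `chartVolume` agree on overlaps of charts, so that their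
supremum is the measure which restricts to `chartVolume` on the domain of each chart. -/
def volumeMeasure [MeasurableSpace M] [BorelSpace M] (g : PseudoRiemannianMetric n M) :
    Measure M :=
  ⨆ x : M, g.chartVolume x

end PseudoRiemannianMetric

end

/-! Write ξ = grad f, c = g(ξ, ξ) and B = ∇^g ξ. The Hessian of a function is symmetric, that is, B
is g-self-adjoint; hence g(∇_ξ ξ, w) = g(∇_w ξ, ξ) = w(c)/2 = 0. So Bξ = 0, and dually df ∘ B = 0
(`covDeriv_grad`). For the deformed connection, ∇^{df} ξ = B + 2 df ⊗ ξ + c I, and therefore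
∇^{df}_ξ ξ = 3c ξ.

The curvature enters through an identity that needs no metric: if a connection is torsion-free and
∇_ξ ξ = a ξ with a constant, then differentiating this equation and taking a trace gives Ric(ξ, ξ) =
a tr(∇ξ) − tr((∇ξ)²) − ξ(tr ∇ξ) (`trace_curv_apply`). For ∇^{df}, with a = 3c, this is a Bochner
formula (`ricci_dfConnection_grad`). Both Hessians are symmetric, so in any signature |Hess|² is the
trace of the square of ∇ξ (`innerTensor_self`). The explicit form of ∇^{df} ξ yields tr ∇^{df} ξ =
Δ^g f + (n+2)c and |Hess^{df}|² = |Hess^g|² + 2c Δ^g f + (n+8)c². The two sums of integrands then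
equal, pointwise, c Δ^g f + 2(n−1)c² and 3c Δ^g f + 3(n+2)c².

Since ∫ Δ^g f = 0 on a closed manifold (`integral_laplacian_eq_zero`), integration gives both
formulas. That vanishing follows from a partition of unity and the Euclidean divergence theorem in
each chart, where the density δ = √|det g| satisfies dδ(v) = δ tr Γ(v) (`hasFDerivAt_sqrt_gramDet`).

All differential identities are proved for a metric on an open subset of a vector space;
`gradientData` and `HasChristoffel` transport them to the manifold through charts. -/

noncomputable section

/-! ### Christoffel symbols and the Ricci trace on an open subset of a vector space. -/

namespace LocalGeometry

set_option maxSynthPendingDepth 3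
set_option autoImplicit false
set_option linter.unusedSectionVars false

variable {E : Type*} [NormedAddCommGroup E] [NormedSpace ℝ E] [FiniteDimensional ℝ E]

/-- The Christoffel symbols of a metric `G` on an open subset of a vector space. -/
def christoffel (G : E → E →L[ℝ] E →L[ℝ] ℝ) (z : E) : E →L[ℝ] E →L[ℝ] E :=
  LinearMap.toContinuousBilinearMap <| LinearMap.mk₂ ℝ
    (fun u v ↦ (G z).inverse ((1 / 2 : ℝ) • (fderiv ℝ G z u v + fderiv ℝ G z v u
      - ((fderiv ℝ G z).flip u).flip v)))
    (by intros; simp only [← map_add, ← smul_add]; congr 2; ext; simp; ring)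
    (by intros; rw [← map_smul]; congr 1; ext; simp; ring)
    (by intros; simp only [← map_add, ← smul_add]; congr 2; ext; simp; ring)
    (by intros; rw [← map_smul]; congr 1; ext; simp; ring)

/-- `christoffel` uses the total function `inverse`, which is zero on maps that are not invertible;
nondegeneracy of the metric ensures that it is a true inverse. -/
theorem isInvertible_of_nondegenerate {B : E →L[ℝ] E →L[ℝ] ℝ}
    (h : ∀ v, (∀ w, B v w = 0) → v = 0) : B.IsInvertible := by
  have hinj : Function.Injective B := by
    rw [injective_iff_map_eq_zero]
    exact fun v hv ↦ h v fun w ↦ by simp [hv]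
  have hfr : Module.finrank ℝ E = Module.finrank ℝ (E →L[ℝ] ℝ) := by
    rw [← (LinearMap.toContinuousLinearMap (𝕜 := ℝ) (E := E) (F' := ℝ)).finrank_eq]
    exact (Subspace.dual_finrank_eq (K := ℝ) (V := E)).symm
  refine ⟨(LinearEquiv.ofInjectiveOfFinrankEq B.toLinearMap hinj hfr).toContinuousLinearEquiv, ?_⟩
  ext; rfl

theorem apply_inverse {B : E →L[ℝ] E →L[ℝ] ℝ} (h : B.IsInvertible) (α : E →L[ℝ] ℝ) :
    B (B.inverse α) = α := by
  obtain ⟨e, rfl⟩ := h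
  simp

theorem metric_christoffel {G : E → E →L[ℝ] E →L[ℝ] ℝ} {z : E} (h : (G z).IsInvertible)
    (u v w : E) :
    G z (christoffel G z u v) w =
      1 / 2 * (fderiv ℝ G z u v w + fderiv ℝ G z v u w - fderiv ℝ G z w u v) := by
  simp [christoffel, apply_inverse h]

/-- Torsion-freeness: exchanging `u` and `v` permutes the first two metric derivatives, and the
third is symmetric in them by `hs`. -/
theorem christoffel_symm (G : E → E →L[ℝ] E →L[ℝ] ℝ) {z : E}
    (hs : ∀ u v w, fderiv ℝ G z u v w = fderiv ℝ G z u w v) (u v : E) :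
    christoffel G z u v = christoffel G z v u := by
  simp only [christoffel, LinearMap.toContinuousBilinearMap_apply, LinearMap.mk₂_apply]
  congr 2
  ext w
  simp [hs w u v]
  ring

theorem fderiv_metric_symm {G : E → E →L[ℝ] E →L[ℝ] ℝ} {z : E} (hG : DifferentiableAt ℝ G z)
    (hs : ∀ᶠ y in 𝓝 z, ∀ v w, G y v w = G y w v) (u v w : E) :
    fderiv ℝ G z u v w = fderiv ℝ G z u w v := by
  have h1 : (fun y ↦ G y v w) =ᶠ[𝓝 z] fun y ↦ G y w v := hs.mono fun y hy ↦ hy v w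
  have h2 (v w : E) : fderiv ℝ (fun y ↦ G y v w) z u = fderiv ℝ G z u v w := by
    rw [fderiv_clm_apply (by fun_prop) (by fun_prop), fderiv_clm_apply (by fun_prop) (by fun_prop)]
    simp
  rw [← h2, ← h2, h1.fderiv_eq]

theorem contDiffOn_inverse {F : Type*} [NormedAddCommGroup F] [NormedSpace ℝ F]
    {A : E → E →L[ℝ] F} {s : Set E} {k : WithTop ℕ∞}
    (hA : ContDiffOn ℝ k A s) (h : ∀ z ∈ s, (A z).IsInvertible) :
    ContDiffOn ℝ k (fun z ↦ (A z).inverse) s := by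
  have : CompleteSpace E := FiniteDimensional.complete ℝ E
  exact fun z hz ↦ ((h z hz).contDiffAt_map_inverse).comp_contDiffWithinAt z (hA z hz)

theorem contDiffOn_christoffel {G : E → E →L[ℝ] E →L[ℝ] ℝ} {s : Set E} (hs : IsOpen s)
    (hG : ContDiffOn ℝ ∞ G s) (h : ∀ z ∈ s, (G z).IsInvertible) :
    ContDiffOn ℝ ∞ (christoffel G) s := by
  have hD : ContDiffOn ℝ ∞ (fderiv ℝ G) s := hG.fderiv_of_isOpen hs (by simp)
  rw [contDiffOn_clm_apply]
  intro u
  rw [contDiffOn_clm_apply]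
  intro v
  simp only [christoffel, LinearMap.toContinuousBilinearMap_apply, LinearMap.mk₂_apply]
  refine (contDiffOn_inverse hG h).clm_apply (ContDiffOn.const_smul _ ?_)
  rw [contDiffOn_clm_apply]
  intro w
  simp only [sub_apply, add_apply,
    ContinuousLinearMap.flip_apply]
  have h3 (a b c : E) : ContDiffOn ℝ ∞ (fun z ↦ fderiv ℝ G z a b c) s :=
    ((hD.clm_apply contDiffOn_const).clm_apply contDiffOn_const).clm_apply contDiffOn_const
  exact ((h3 u v w).add (h3 v u w)).sub (h3 w u v)

/-- The curvature of the connection with Christoffel symbols `Γ`. -/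
def curv (Γ : E → E →L[ℝ] E →L[ℝ] E) (z u v w : E) : E :=
  fderiv ℝ Γ z u v w - fderiv ℝ Γ z v u w + Γ z u (Γ z v w) - Γ z v (Γ z u w)

/-- The covariant derivative of the vector field `ξ`, as a field of endomorphisms. -/
def covDeriv (Γ : E → E →L[ℝ] E →L[ℝ] E) (ξ : E → E) (z : E) : E →L[ℝ] E :=
  fderiv ℝ ξ z + (Γ z).flip (ξ z)

@[simp]
theorem covDeriv_apply (Γ : E → E →L[ℝ] E →L[ℝ] E) (ξ : E → E) (z u : E) :
    covDeriv Γ ξ z u = fderiv ℝ ξ z u + Γ z u (ξ z) := by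
  simp [covDeriv]

/-- The trace as a continuous linear map. -/
def traceCLM : (E →L[ℝ] E) →L[ℝ] ℝ :=
  LinearMap.toContinuousLinearMap (LinearMap.trace ℝ E ∘ₗ ContinuousLinearMap.coeLM ℝ)

@[simp]
theorem traceCLM_apply (A : E →L[ℝ] E) : traceCLM A = LinearMap.trace ℝ E A.toLinearMap := rfl

theorem traceCLM_comp_comm (A B : E →L[ℝ] E) : traceCLM (A ∘L B) = traceCLM (B ∘L A) :=
  LinearMap.trace_comp_comm' (B : E →ₗ[ℝ] E) (A : E →ₗ[ℝ] E)

theorem contDiffOn_covDeriv {Γ : E → E →L[ℝ] E →L[ℝ] E} {ξ : E → E} {s : Set E} (hs : IsOpen s)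
    (hΓ : ContDiffOn ℝ ∞ Γ s) (hξ : ContDiffOn ℝ ∞ ξ s) : ContDiffOn ℝ ∞ (covDeriv Γ ξ) s := by
  rw [contDiffOn_clm_apply]
  intro u
  simp only [covDeriv_apply]
  exact ((hξ.fderiv_of_isOpen hs (by simp)).clm_apply contDiffOn_const).add
    ((hΓ.clm_apply contDiffOn_const).clm_apply hξ)

/-- The Ricci curvature in the direction of a field `ξ` with `∇_ξ ξ = a ξ`, `a` constant, for a
torsion-free connection. -/
theorem trace_curv_apply {Γ : E → E →L[ℝ] E →L[ℝ] E} {ξ : E → E} {s : Set E} (hs : IsOpen s)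
    (hΓ : ContDiffOn ℝ ∞ Γ s) (hξ : ContDiffOn ℝ ∞ ξ s)
    (hsymm : ∀ z ∈ s, ∀ u v, Γ z u v = Γ z v u) {a : ℝ}
    (ha : ∀ z ∈ s, covDeriv Γ ξ z (ξ z) = a • ξ z) {z : E} (hz : z ∈ s)
    {L : E →L[ℝ] E} (hL : ∀ u, L u = curv Γ z u (ξ z) (ξ z)) :
    traceCLM L = a * traceCLM (covDeriv Γ ξ z) -
      traceCLM (covDeriv Γ ξ z ∘L covDeriv Γ ξ z) -
      fderiv ℝ (fun y ↦ traceCLM (covDeriv Γ ξ y)) z (ξ z) := by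
  have hsz := hs.mem_nhds hz
  have dξ : DifferentiableAt ℝ ξ z := (hξ.contDiffAt hsz).differentiableAt (by simp)
  have dΓ : DifferentiableAt ℝ Γ z := (hΓ.contDiffAt hsz).differentiableAt (by simp)
  have dDξ : DifferentiableAt ℝ (fderiv ℝ ξ) z :=
    ((hξ.fderiv_of_isOpen hs (m := ∞) (by simp)).contDiffAt hsz).differentiableAt (by simp)
  have dB : DifferentiableAt ℝ (covDeriv Γ ξ) z :=
    ((contDiffOn_covDeriv hs hΓ hξ).contDiffAt hsz).differentiableAt (by simp)
  set B := covDeriv Γ ξ with hB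
  have hDB (u v : E) : fderiv ℝ B z u v =
      fderiv ℝ (fderiv ℝ ξ) z u v + fderiv ℝ Γ z u v (ξ z) + Γ z v (fderiv ℝ ξ z u) := by
    have h1 : fderiv ℝ (fun y ↦ B y v) z u = fderiv ℝ B z u v := by
      rw [fderiv_clm_apply dB (by fun_prop)]; simp
    rw [← h1]
    simp only [hB, covDeriv_apply]
    rw [fderiv_fun_add (by fun_prop) (by fun_prop), fderiv_clm_apply dDξ (by fun_prop),
      fderiv_clm_apply (by fun_prop) dξ, fderiv_clm_apply dΓ (by fun_prop)]
    simp
    abel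
  have hsnd (u v : E) : fderiv ℝ (fderiv ℝ ξ) z u v = fderiv ℝ (fderiv ℝ ξ) z v u :=
    ((hξ.contDiffAt hsz).isSymmSndFDerivAt (by simp; norm_cast)) u v
  -- The equation `∇_ξ ξ = a ξ` holds on the whole open set, so it can be differentiated at `z`.
  have hBξ (u : E) : fderiv ℝ B z u (ξ z) + B z (fderiv ℝ ξ z u) = a • fderiv ℝ ξ z u := by
    have h1 : (fun y ↦ B y (ξ y)) =ᶠ[𝓝 z] fun y ↦ a • ξ y := by
      filter_upwards [hsz] with y hy using ha y hy
    have h2 := DFunLike.congr_fun (h1.fderiv_eq (𝕜 := ℝ)) u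
    rw [fderiv_clm_apply dB dξ, fderiv_fun_const_smul dξ a] at h2
    simpa [add_comm] using h2
  -- This says `R(·, ξ)ξ = a B − B² − ∇_ξ B` with `∇_ξ B = ∂_ξ B + [Γ(ξ), B]`. The commutator has
  -- trace zero, so only `∂_ξ B` survives below.
  have key : L = a • B z - B z ∘L B z - fderiv ℝ B z (ξ z) - Γ z (ξ z) ∘L B z
      + B z ∘L Γ z (ξ z) := by
    ext u
    have e1 := hBξ u
    rw [hDB] at e1
    have e2 := hDB (ξ z) u
    have e3 := ha z hz
    simp only [hL, curv, add_apply, sub_apply,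
      smul_apply, ContinuousLinearMap.comp_apply]
    rw [e2, hsnd (ξ z) u]
    have e4 : B z u = fderiv ℝ ξ z u + Γ z u (ξ z) := covDeriv_apply ..
    have e5 : Γ z u (B z (ξ z)) = a • Γ z u (ξ z) := by rw [← map_smul, ← e3]
    rw [show B z (ξ z) = fderiv ℝ ξ z (ξ z) + Γ z (ξ z) (ξ z) from covDeriv_apply ..] at e5
    rw [e4, map_add, map_add, smul_add, ← e5, map_add, ← e1, hsymm z hz (ξ z) u]
    abel
  rw [key]
  have h1 : fderiv ℝ (fun y ↦ traceCLM (B y)) z (ξ z) = traceCLM (fderiv ℝ B z (ξ z)) := by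
    have := (traceCLM (E := E)).hasFDerivAt.comp z dB.hasFDerivAt
    rw [show (fun y ↦ traceCLM (B y)) = traceCLM ∘ B from rfl, this.fderiv]
    rfl
  rw [map_add, map_sub, map_sub, map_sub, map_smul, traceCLM_comp_comm (Γ z (ξ z)), h1, smul_eq_mul]
  ring

end LocalGeometry
end

/-! ### Gradients of constant length and the deformed connection, in coordinates. -/

noncomputable section

namespace LocalGeometry

set_option maxSynthPendingDepth 3
set_option autoImplicit false
set_option linter.unusedSectionVars false

variable {E : Type*} [NormedAddCommGroup E] [NormedSpace ℝ E] [FiniteDimensional ℝ E]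

/-- A metric `G`, a function `F` and its gradient `ξ` on an open subset `s` of a vector space. -/
structure GradientData (s : Set E) (G : E → E →L[ℝ] E →L[ℝ] ℝ) (F : E → ℝ) (ξ : E → E) :
    Prop where
  isOpen : IsOpen s
  contDiffOn_metric : ContDiffOn ℝ ∞ G s
  symm : ∀ z ∈ s, ∀ u v, G z u v = G z v u
  isInvertible : ∀ z ∈ s, (G z).IsInvertible
  contDiffOn_fun : ContDiffOn ℝ ∞ F s
  contDiffOn_grad : ContDiffOn ℝ ∞ ξ s
  metric_grad : ∀ z ∈ s, ∀ w, G z (ξ z) w = fderiv ℝ F z w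

theorem eq_of_apply_eq {B : E →L[ℝ] E →L[ℝ] ℝ} (h : B.IsInvertible) {v v' : E}
    (hv : ∀ w, B v w = B v' w) : v = v' :=
  h.injective (ContinuousLinearMap.ext hv)

/-- The Christoffel symbols of `Γ + η ⊗ I + I ⊗ η + G ⊗ ξ`. -/
def deformedChristoffel (Γ : E → E →L[ℝ] E →L[ℝ] E) (G : E → E →L[ℝ] E →L[ℝ] ℝ)
    (η : E → E →L[ℝ] ℝ) (ξ : E → E) (z : E) : E →L[ℝ] E →L[ℝ] E :=
  Γ z + LinearMap.toContinuousBilinearMap (LinearMap.mk₂ ℝ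
    (fun u v ↦ η z u • v + η z v • u + G z u v • ξ z)
    (by intros; simp; module) (by intros; simp; module)
    (by intros; simp; module) (by intros; simp; module))

@[simp]
theorem deformedChristoffel_apply (Γ : E → E →L[ℝ] E →L[ℝ] E) (G : E → E →L[ℝ] E →L[ℝ] ℝ)
    (η : E → E →L[ℝ] ℝ) (ξ : E → E) (z u v : E) :
    deformedChristoffel Γ G η ξ z u v =
      Γ z u v + (η z u • v + η z v • u + G z u v • ξ z) := by
  simp [deformedChristoffel]

theorem contDiffOn_deformedChristoffel {Γ : E → E →L[ℝ] E →L[ℝ] E} {G : E → E →L[ℝ] E →L[ℝ] ℝ}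
    {η : E → E →L[ℝ] ℝ} {ξ : E → E} {s : Set E} (hΓ : ContDiffOn ℝ ∞ Γ s)
    (hG : ContDiffOn ℝ ∞ G s) (hη : ContDiffOn ℝ ∞ η s) (hξ : ContDiffOn ℝ ∞ ξ s) :
    ContDiffOn ℝ ∞ (deformedChristoffel Γ G η ξ) s := by
  rw [contDiffOn_clm_apply]
  intro u
  rw [contDiffOn_clm_apply]
  intro v
  simp only [deformedChristoffel_apply]
  exact ((hΓ.clm_apply contDiffOn_const).clm_apply contDiffOn_const).add
    ((((hη.clm_apply contDiffOn_const).smul contDiffOn_const).add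
      ((hη.clm_apply contDiffOn_const).smul contDiffOn_const)).add
      (((hG.clm_apply contDiffOn_const).clm_apply contDiffOn_const).smul hξ))

theorem traceCLM_smulRight (α : E →L[ℝ] ℝ) (v : E) :
    traceCLM (α.smulRight v) = α v := by
  rw [traceCLM_apply]
  exact LinearMap.trace_smulRight (R := ℝ) (M := E) α.toLinearMap v

theorem traceCLM_id : traceCLM (ContinuousLinearMap.id ℝ E) = Module.finrank ℝ E := by
  rw [traceCLM_apply]
  exact LinearMap.trace_id ℝ E

namespace GradientData

variable {s : Set E} {G : E → E →L[ℝ] E →L[ℝ] ℝ} {F : E → ℝ} {ξ : E → E}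

theorem differentiableAt_metric (h : GradientData s G F ξ) {z : E} (hz : z ∈ s) :
    DifferentiableAt ℝ G z :=
  (h.contDiffOn_metric.contDiffAt (h.isOpen.mem_nhds hz)).differentiableAt (by simp)

theorem differentiableAt_grad (h : GradientData s G F ξ) {z : E} (hz : z ∈ s) :
    DifferentiableAt ℝ ξ z :=
  (h.contDiffOn_grad.contDiffAt (h.isOpen.mem_nhds hz)).differentiableAt (by simp)

theorem fderiv_symm (h : GradientData s G F ξ) {z : E} (hz : z ∈ s) (u v w : E) :
    fderiv ℝ G z u v w = fderiv ℝ G z u w v :=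
  fderiv_metric_symm (h.differentiableAt_metric hz)
    (by filter_upwards [h.isOpen.mem_nhds hz] with y hy using h.symm y hy) u v w

theorem contDiffOn_fderiv (h : GradientData s G F ξ) : ContDiffOn ℝ ∞ (fderiv ℝ F) s :=
  h.contDiffOn_fun.fderiv_of_isOpen h.isOpen (by simp)

theorem metric_fderiv_grad (h : GradientData s G F ξ) {z : E} (hz : z ∈ s) (u w : E) :
    G z (fderiv ℝ ξ z u) w = fderiv ℝ (fderiv ℝ F) z u w - fderiv ℝ G z u (ξ z) w := by
  have dG := h.differentiableAt_metric hz
  have dξ := h.differentiableAt_grad hz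
  have dF : DifferentiableAt ℝ (fderiv ℝ F) z :=
    (h.contDiffOn_fderiv.contDiffAt (h.isOpen.mem_nhds hz)).differentiableAt (by simp)
  have h1 : (fun y ↦ G y (ξ y) w) =ᶠ[𝓝 z] fun y ↦ fderiv ℝ F y w := by
    filter_upwards [h.isOpen.mem_nhds hz] with y hy using h.metric_grad y hy w
  have h2 := DFunLike.congr_fun (h1.fderiv_eq (𝕜 := ℝ)) u
  simp only [fderiv_clm_apply (dG.clm_apply dξ) (differentiableAt_const w),
    fderiv_clm_apply dG dξ, fderiv_clm_apply dF (differentiableAt_const w)] at h2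
  simp at h2
  linarith

theorem metric_covDeriv (h : GradientData s G F ξ) {z : E} (hz : z ∈ s) (u w : E) :
    G z (covDeriv (christoffel G) ξ z u) w = fderiv ℝ (fderiv ℝ F) z u w
      + 1 / 2 * (fderiv ℝ G z (ξ z) u w - fderiv ℝ G z u (ξ z) w - fderiv ℝ G z w u (ξ z)) := by
  rw [covDeriv_apply, map_add, add_apply, h.metric_fderiv_grad hz,
    metric_christoffel (h.isInvertible z hz)]
  ring

/-- In `metric_covDeriv` the second derivative of `F` is symmetric, and exchanging `u` and `w` swaps
the last two metric derivatives. -/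
theorem metric_covDeriv_symm (h : GradientData s G F ξ) {z : E} (hz : z ∈ s) (u w : E) :
    G z (covDeriv (christoffel G) ξ z u) w = G z (covDeriv (christoffel G) ξ z w) u := by
  have hsnd : fderiv ℝ (fderiv ℝ F) z u w = fderiv ℝ (fderiv ℝ F) z w u :=
    ((h.contDiffOn_fun.contDiffAt (h.isOpen.mem_nhds hz)).isSymmSndFDerivAt
      (by simp; norm_cast)) u w
  rw [h.metric_covDeriv hz, h.metric_covDeriv hz, hsnd, h.fderiv_symm hz (ξ z),
    h.fderiv_symm hz u, h.fderiv_symm hz w]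
  ring

/-- The integral curves of a gradient of constant length are geodesics: by symmetry of the Hessian,
`G(∇_ξ ξ, w) = G(∇_w ξ, ξ)`, which is half the derivative of the constant `G(ξ, ξ)` along `w`. -/
theorem covDeriv_grad (h : GradientData s G F ξ) {c : ℝ} (hc : ∀ z ∈ s, G z (ξ z) (ξ z) = c)
    {z : E} (hz : z ∈ s) : covDeriv (christoffel G) ξ z (ξ z) = 0 := by
  refine eq_of_apply_eq (h.isInvertible z hz) fun w ↦ ?_
  have dG := h.differentiableAt_metric hz
  have dξ := h.differentiableAt_grad hz
  have h1 : (fun y ↦ G y (ξ y) (ξ y)) =ᶠ[𝓝 z] fun y ↦ c := by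
    filter_upwards [h.isOpen.mem_nhds hz] with y hy using hc y hy
  have h2 := DFunLike.congr_fun (h1.fderiv_eq (𝕜 := ℝ)) w
  simp only [fderiv_clm_apply (dG.clm_apply dξ) dξ, fderiv_clm_apply dG dξ] at h2
  simp at h2
  rw [h.symm z hz (ξ z), h.metric_fderiv_grad hz] at h2
  rw [h.metric_covDeriv_symm hz, h.metric_covDeriv hz, map_zero, zero_apply,
    h.fderiv_symm hz (ξ z) w]
  linarith

/-- The Christoffel symbols of the connection `∇^{dF}`. -/
abbrev dfChristoffel (_ : GradientData s G F ξ) : E → E →L[ℝ] E →L[ℝ] E :=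
  deformedChristoffel (christoffel G) G (fderiv ℝ F) ξ

theorem contDiffOn_christoffel (h : GradientData s G F ξ) : ContDiffOn ℝ ∞ (christoffel G) s :=
  LocalGeometry.contDiffOn_christoffel h.isOpen h.contDiffOn_metric h.isInvertible

theorem contDiffOn_dfChristoffel (h : GradientData s G F ξ) :
    ContDiffOn ℝ ∞ h.dfChristoffel s :=
  contDiffOn_deformedChristoffel h.contDiffOn_christoffel h.contDiffOn_metric
    h.contDiffOn_fderiv h.contDiffOn_grad

/-- Of the three added terms, `dF(u) ξ` and `G(u, ξ) ξ` coincide, whence the factor 2, and `dF(ξ) u`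
is `c u`. -/
theorem covDeriv_dfChristoffel (h : GradientData s G F ξ) {c : ℝ}
    (hc : ∀ z ∈ s, G z (ξ z) (ξ z) = c) {z : E} (hz : z ∈ s) :
    covDeriv h.dfChristoffel ξ z = covDeriv (christoffel G) ξ z
      + (2 : ℝ) • (fderiv ℝ F z).smulRight (ξ z) + c • ContinuousLinearMap.id ℝ E := by
  ext u
  have h1 : fderiv ℝ F z (ξ z) = c := by rw [← h.metric_grad z hz, hc z hz]
  simp [h1, h.symm z hz u, h.metric_grad z hz u]
  module

theorem traceCLM_covDeriv_dfChristoffel (h : GradientData s G F ξ) {c : ℝ}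
    (hc : ∀ z ∈ s, G z (ξ z) (ξ z) = c) {z : E} (hz : z ∈ s) :
    traceCLM (covDeriv h.dfChristoffel ξ z) =
      traceCLM (covDeriv (christoffel G) ξ z) + (Module.finrank ℝ E + 2) * c := by
  have h1 : fderiv ℝ F z (ξ z) = c := by rw [← h.metric_grad z hz, hc z hz]
  rw [h.covDeriv_dfChristoffel hc hz, map_add, map_add, map_smul, map_smul, traceCLM_smulRight,
    traceCLM_id, h1]
  simp only [smul_eq_mul]
  ring

theorem traceCLM_covDeriv_dfChristoffel_comp (h : GradientData s G F ξ) {c : ℝ}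
    (hc : ∀ z ∈ s, G z (ξ z) (ξ z) = c) {z : E} (hz : z ∈ s) :
    traceCLM (covDeriv h.dfChristoffel ξ z ∘L covDeriv h.dfChristoffel ξ z) =
      traceCLM (covDeriv (christoffel G) ξ z ∘L covDeriv (christoffel G) ξ z)
      + 2 * c * traceCLM (covDeriv (christoffel G) ξ z) + (Module.finrank ℝ E + 8) * c ^ 2 := by
  have h1 : fderiv ℝ F z (ξ z) = c := by rw [← h.metric_grad z hz, hc z hz]
  have h0 := h.covDeriv_grad hc hz
  -- The dual of `Bξ = 0`: `dF(Bu) = G(ξ, Bu) = G(Bξ, u)`, as `B` is self-adjoint.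
  have h2 (u : E) : fderiv ℝ F z (covDeriv (christoffel G) ξ z u) = 0 := by
    rw [← h.metric_grad z hz, h.symm z hz, h.metric_covDeriv_symm hz, h0]
    simp
  rw [h.covDeriv_dfChristoffel hc hz]
  set B := covDeriv (christoffel G) ξ z
  -- The products of `B` with `dF ⊗ ξ` vanish. The coefficient `8c` is `4c` from the square of `2 dF
  -- ⊗ ξ`, since `(dF ⊗ ξ)² = c dF ⊗ ξ`, plus `4c` from its two products with `c I`.
  have key : (B + (2 : ℝ) • (fderiv ℝ F z).smulRight (ξ z) + c • ContinuousLinearMap.id ℝ E) ∘L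
      (B + (2 : ℝ) • (fderiv ℝ F z).smulRight (ξ z) + c • ContinuousLinearMap.id ℝ E) =
      B ∘L B + (2 * c) • B + (8 * c) • (fderiv ℝ F z).smulRight (ξ z)
        + (c ^ 2) • ContinuousLinearMap.id ℝ E := by
    ext u
    simp [h0, h1, h2]
    module
  rw [key, map_add, map_add, map_add, map_smul, map_smul, map_smul, traceCLM_smulRight,
    traceCLM_id, h1]
  simp only [smul_eq_mul]
  ring

/-- The deformation is symmetric in its two arguments, so the connection stays torsion-free, and
`∇_ξ ξ = 0 + 2c ξ + c ξ`. Thus `trace_curv_apply` applies with `a = 3c`. -/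
theorem traceCLM_curv_dfChristoffel (h : GradientData s G F ξ) {c : ℝ}
    (hc : ∀ z ∈ s, G z (ξ z) (ξ z) = c) {z : E} (hz : z ∈ s)
    {L : E →L[ℝ] E} (hL : ∀ u, L u = curv h.dfChristoffel z u (ξ z) (ξ z)) :
    traceCLM L = 3 * c * traceCLM (covDeriv h.dfChristoffel ξ z) -
      traceCLM (covDeriv h.dfChristoffel ξ z ∘L covDeriv h.dfChristoffel ξ z) -
      fderiv ℝ (fun y ↦ traceCLM (covDeriv h.dfChristoffel ξ y)) z (ξ z) := by
  refine trace_curv_apply h.isOpen h.contDiffOn_dfChristoffel h.contDiffOn_grad ?_ ?_ hz hL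
  · intro y hy u v
    simp only [dfChristoffel, deformedChristoffel_apply]
    rw [christoffel_symm G (h.fderiv_symm hy), h.symm y hy]
    module
  · intro y hy
    have h1 : fderiv ℝ F y (ξ y) = c := by rw [← h.metric_grad y hy, hc y hy]
    rw [h.covDeriv_dfChristoffel hc hy]
    simp only [add_apply, smul_apply, h.covDeriv_grad hc hy, ContinuousLinearMap.smulRight_apply,
      h1, ContinuousLinearMap.id_apply]
    module

/-- Compatibility of the connection with the metric, from which the derivative of the Gram
determinant is computed. -/
theorem fderiv_metric (h : GradientData s G F ξ) {z : E} (hz : z ∈ s) (v a b : E) :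
    fderiv ℝ G z v a b = G z (christoffel G z v a) b + G z a (christoffel G z v b) := by
  rw [h.symm z hz a, metric_christoffel (h.isInvertible z hz),
    metric_christoffel (h.isInvertible z hz), h.fderiv_symm hz v b a, h.fderiv_symm hz a v b,
    h.fderiv_symm hz b v a]
  ring

end GradientData

/-! ### The derivative of the Riemannian density. -/

open Matrix in
-- Jacobi's formula. The determinant is multilinear in the rows, so its derivative is a sum over
-- replaced rows, and Cramer's rule expands each such determinant through the adjugate.
theorem hasFDerivAt_det {ι : Type*} [Fintype ι] [DecidableEq ι] {A : E → Matrix ι ι ℝ}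
    {A' : ι → ι → E →L[ℝ] ℝ} {z : E} (hA : ∀ i j, HasFDerivAt (fun y ↦ A y i j) (A' i j) z) :
    HasFDerivAt (fun y ↦ (A y).det)
      (∑ i, ∑ j, (A z).adjugate j i • A' i j) z := by
  let D : ContinuousMultilinearMap ℝ (fun _ : ι ↦ ι → ℝ) ℝ :=
    ⟨(Matrix.detRowAlternating (n := ι) (R := ℝ)).toMultilinearMap,
      Continuous.matrix_det (A := fun B : ι → ι → ℝ ↦ (B : Matrix ι ι ℝ)) continuous_id⟩
  have h1 : HasFDerivAt (fun y ↦ (A y : ι → ι → ℝ))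
      (ContinuousLinearMap.pi fun i ↦ ContinuousLinearMap.pi fun j ↦ A' i j) z :=
    hasFDerivAt_pi.2 fun i ↦ hasFDerivAt_pi.2 fun j ↦ hA i j
  have h2 := (D.hasFDerivAt (A z)).comp z h1
  refine h2.congr_fderiv ?_
  ext v
  simp only [ContinuousLinearMap.comp_apply, _root_.sum_apply, _root_.smul_apply, smul_eq_mul]
  refine (ContinuousMultilinearMap.linearDeriv_apply ..).trans ?_
  refine Finset.sum_congr rfl fun i _ ↦ ?_
  change ((A z).updateRow i _).det = _
  rw [← Matrix.cramer_transpose_apply, Matrix.cramer_eq_adjugate_mulVec,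
    ← Matrix.adjugate_transpose]
  simp [Matrix.mulVec, dotProduct]

namespace GradientData

variable {s : Set E} {G : E → E →L[ℝ] E →L[ℝ] ℝ} {F : E → ℝ} {ξ : E → E}
  {ι : Type*} [Fintype ι] [DecidableEq ι]

/-- The Gram determinant of `G` in the basis `b`. -/
def gramDet (G : E → E →L[ℝ] E →L[ℝ] ℝ) (b : Module.Basis ι ℝ E) (z : E) : ℝ :=
  (Matrix.of fun i j ↦ G z (b i) (b j)).det

/-- Let `C` be the matrix of `Γ(v)`. Metric compatibility makes the derivative of the Gram matrix
`A` equal to `CᵀA + AC`, and Jacobi's formula turns this into `2 det A tr C`. -/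
theorem fderiv_gramDet (h : GradientData s G F ξ) (b : Module.Basis ι ℝ E) {z : E} (hz : z ∈ s)
    (v : E) : HasFDerivAt (gramDet G b) (fderiv ℝ (gramDet G b) z) z ∧
      fderiv ℝ (gramDet G b) z v =
      2 * gramDet G b z * traceCLM (christoffel G z v) := by
  set A := Matrix.of fun i j ↦ G z (b i) (b j) with hA
  have h1 (i j : ι) : HasFDerivAt (fun y ↦ (Matrix.of fun i j ↦ G y (b i) (b j)) i j)
      (((fderiv ℝ G z).flip (b i)).flip (b j)) z := by
    have dG := h.differentiableAt_metric hz
    have := (dG.hasFDerivAt.clm_apply (hasFDerivAt_const (b i) z)).clm_apply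
      (hasFDerivAt_const (b j) z)
    refine this.congr_fderiv ?_
    ext; simp
  have h2 := hasFDerivAt_det h1
  refine ⟨h2.differentiableAt.hasFDerivAt, ?_⟩
  change fderiv ℝ (fun y ↦ (Matrix.of fun i j ↦ G y (b i) (b j)).det) z v = _
  rw [h2.fderiv]
  set C := LinearMap.toMatrix b b (christoffel G z v).toLinearMap with hC
  have h3 (i : ι) : christoffel G z v (b i) = ∑ k, C k i • b k :=
    by
    simp only [hC, LinearMap.toMatrix_apply]
    exact (b.sum_repr _).symm
  have h4 (i j : ι) : fderiv ℝ G z v (b i) (b j) = (C.transpose * A + A * C) i j := by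
    rw [h.fderiv_metric hz, h3, h3]
    simp [Matrix.mul_apply, hA, mul_comm]
  have h5 : traceCLM (christoffel G z v) = C.trace := by
    rw [traceCLM_apply, LinearMap.trace_eq_matrix_trace ℝ b]
  have h6 : ∑ i, ∑ j, A.adjugate j i * (C.transpose * A + A * C) i j =
      ((C.transpose * A + A * C) * A.adjugate).trace := by
    simp only [Matrix.trace, Matrix.diag, Matrix.mul_apply (N := A.adjugate), mul_comm]
  simp only [sum_apply, smul_apply, ContinuousLinearMap.flip_apply, h4,
    smul_eq_mul]
  rw [← hA, h6, h5, add_mul, Matrix.mul_assoc, Matrix.mul_adjugate, Matrix.trace_add,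
    Matrix.mul_assoc A, Matrix.trace_mul_comm A, Matrix.mul_assoc, Matrix.adjugate_mul]
  simp [gramDet, ← hA, Matrix.trace_smul]
  ring

theorem gramDet_ne_zero (h : GradientData s G F ξ) (b : Module.Basis ι ℝ E) {z : E} (hz : z ∈ s) :
    gramDet G b z ≠ 0 := by
  let B : LinearMap.BilinForm ℝ E := LinearMap.mk₂ ℝ (fun v w ↦ G z v w)
    (by simp) (by simp) (by simp) (by simp)
  have hB : B.Nondegenerate := by
    have h1 (v : E) (hv : ∀ w, G z v w = 0) : v = 0 :=
      eq_of_apply_eq (h.isInvertible z hz) fun w ↦ by simp [hv w]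
    exact ⟨h1, fun v hv ↦ h1 v fun w ↦ by rw [h.symm z hz]; exact hv w⟩
  have := (LinearMap.BilinForm.nondegenerate_iff_det_ne_zero (B := B) b).1 hB
  convert this
  simp [gramDet]
  congr 1
  ext i j
  simp [B, LinearMap.BilinForm.toMatrix_apply]

theorem hasFDerivAt_sqrt_gramDet (h : GradientData s G F ξ) (b : Module.Basis ι ℝ E) {z : E}
    (hz : z ∈ s) : HasFDerivAt (fun y ↦ √|gramDet G b y|)
      (√|gramDet G b z| • (traceCLM ∘L (christoffel G z))) z := by
  have h1 := (h.fderiv_gramDet b hz 0).1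
  -- `Real.log` is the logarithm of the absolute value, so this form covers both signs of the
  -- determinant at once.
  have h2 : (fun y ↦ √|gramDet G b y|) =ᶠ[𝓝 z]
      fun y ↦ Real.exp (1 / 2 * Real.log (gramDet G b y)) := by
    filter_upwards [h.isOpen.mem_nhds hz] with y hy
    have := abs_pos.2 (h.gramDet_ne_zero b hy)
    rw [← Real.log_abs, one_div_mul_eq_div, ← Real.log_sqrt this.le,
      Real.exp_log (Real.sqrt_pos.2 this)]
  have h3 := ((h1.log (h.gramDet_ne_zero b hz)).const_mul (1 / 2)).exp
  refine (h3.congr_of_eventuallyEq h2).congr_fderiv ?_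
  ext v
  have h4 := h2.eq_of_nhds
  simp only [smul_apply, smul_eq_mul, (h.fderiv_gramDet b hz v).2, ContinuousLinearMap.comp_apply]
  rw [← h4]
  field_simp [h.gramDet_ne_zero b hz]

end GradientData

end LocalGeometry
end

/-! ### Vector fields, derivatives and Lie brackets in a chart. -/

noncomputable section

namespace PseudoRiemannianMetric

set_option maxSynthPendingDepth 3
set_option autoImplicit false
set_option linter.unusedSectionVars false

open LocalGeometry

variable {n : ℕ} {M : Type*} [TopologicalSpace M] [ChartedSpace (EuclideanSpace ℝ (Fin n)) M]
  [IsManifold (𝓡 n) ∞ M]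

local notation "𝔼" => EuclideanSpace ℝ (Fin n)

instance : IsManifold (𝓡 n) 1 M := .of_le (m := 1) (n := ∞) (by norm_cast)
instance : IsManifold (𝓡 n) 2 M := .of_le (m := 2) (n := ∞) (by norm_cast)

instance : IsManifold (𝓡 n) (minSmoothness ℝ 2) M := by simp; infer_instance

theorem isOpen_target (x₀ : M) : IsOpen (extChartAt (𝓡 n) x₀).target := isOpen_extChartAt_target x₀

theorem contMDiffAt_symm {x₀ : M} {z : 𝔼} (hz : z ∈ (extChartAt (𝓡 n) x₀).target) :
    ContMDiffAt (𝓡 n) (𝓡 n) ∞ (extChartAt (𝓡 n) x₀).symm z :=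
  (contMDiffOn_extChartAt_symm x₀).contMDiffAt ((isOpen_target x₀).mem_nhds hz)

theorem mdifferentiableAt_symm {x₀ : M} {z : 𝔼} (hz : z ∈ (extChartAt (𝓡 n) x₀).target) :
    MDifferentiableAt (𝓡 n) (𝓡 n) (extChartAt (𝓡 n) x₀).symm z :=
  (contMDiffAt_symm hz).mdifferentiableAt (by simp)

/-- The coordinate frame of the chart at `x₀`, at the point with coordinates `z`. -/
def chartFrame (x₀ : M) (z : 𝔼) : 𝔼 →L[ℝ] TangentSpace (𝓡 n) ((extChartAt (𝓡 n) x₀).symm z) :=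
  mfderiv (𝓡 n) (𝓡 n) (extChartAt (𝓡 n) x₀).symm z

theorem isInvertible_chartFrame {x₀ : M} {z : 𝔼} (hz : z ∈ (extChartAt (𝓡 n) x₀).target) :
    (chartFrame x₀ z).IsInvertible := by
  have := isInvertible_mfderivWithin_extChartAt_symm (I := 𝓡 n) hz
  rw [ModelWithCorners.range_eq_univ, mfderivWithin_univ] at this
  exact this

/-- The coordinate expression of a vector field in the chart at `x₀`. -/
def localField (x₀ : M) (X : Π x : M, TangentSpace (𝓡 n) x) (z : 𝔼) : 𝔼 :=
  (chartFrame x₀ z).inverse (X ((extChartAt (𝓡 n) x₀).symm z))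

theorem chartFrame_localField {x₀ : M} {z : 𝔼} (hz : z ∈ (extChartAt (𝓡 n) x₀).target)
    (X : Π x : M, TangentSpace (𝓡 n) x) :
    chartFrame x₀ z (localField x₀ X z) = X ((extChartAt (𝓡 n) x₀).symm z) := by
  obtain ⟨e, he⟩ := isInvertible_chartFrame hz
  rw [localField, ← he, ContinuousLinearMap.inverse_equiv]
  exact e.apply_symm_apply _

theorem inverse_chartFrame_apply {x₀ : M} {z : 𝔼} (hz : z ∈ (extChartAt (𝓡 n) x₀).target)
    (u : 𝔼) : (chartFrame x₀ z).inverse (chartFrame x₀ z u) = u := by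
  obtain ⟨e, he⟩ := isInvertible_chartFrame hz
  rw [← he, ContinuousLinearMap.inverse_equiv]
  exact e.symm_apply_apply _

theorem chartFrame_inverse_apply {x₀ : M} {z : 𝔼} (hz : z ∈ (extChartAt (𝓡 n) x₀).target)
    (v : TangentSpace (𝓡 n) ((extChartAt (𝓡 n) x₀).symm z)) :
    chartFrame x₀ z ((chartFrame x₀ z).inverse v) = v := by
  obtain ⟨e, he⟩ := isInvertible_chartFrame hz
  rw [← he, ContinuousLinearMap.inverse_equiv]
  exact e.apply_symm_apply _

/-- Gives access to the general results on pullbacks of vector fields, in particular the naturality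
of the Lie bracket. -/
theorem localField_eq_mpullback (x₀ : M) (X : Π x : M, TangentSpace (𝓡 n) x) :
    localField x₀ X = VectorField.mpullback (𝓡 n) (𝓡 n) (extChartAt (𝓡 n) x₀).symm X := rfl

theorem differentiableAt_localField {x₀ : M} {z : 𝔼} (hz : z ∈ (extChartAt (𝓡 n) x₀).target)
    {X : Π x : M, TangentSpace (𝓡 n) x} (hX : DiffAt X ((extChartAt (𝓡 n) x₀).symm z)) :
    DifferentiableAt ℝ (localField x₀ X) z := by
  have := MDifferentiableAt.mpullback_vectorField (n := ∞) hX (contMDiffAt_symm hz)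
    (isInvertible_chartFrame hz) (by norm_cast)
  rw [mdifferentiableAt_section] at this
  rw [← mdifferentiableAt_iff_differentiableAt]
  simpa using! this

/-- The extension of the vector `u` to a field which is constant in the chart at `x₀`. -/
def coordField (x₀ : M) (u : 𝔼) (y : M) : TangentSpace (𝓡 n) y :=
  (trivializationAt 𝔼 (TangentSpace (𝓡 n)) x₀).symm y u

/-- Fields constant in the trivialization at `x₀` are the constant-coefficient combinations of the
coordinate fields; this links the extensions in `curvature` to the chart. -/
theorem coordField_symm {x₀ : M} {z : 𝔼} (hz : z ∈ (extChartAt (𝓡 n) x₀).target) (u : 𝔼) :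
    coordField x₀ u ((extChartAt (𝓡 n) x₀).symm z) = chartFrame x₀ z u := by
  have h := TangentBundle.symmL_trivializationAt (I := 𝓡 n) (x₀ := x₀)
    (x := (extChartAt (𝓡 n) x₀).symm z)
    (by simpa using (extChartAt (𝓡 n) x₀).map_target hz)
  rw [(extChartAt (𝓡 n) x₀).right_inv hz] at h
  have h' := DFunLike.congr_fun h u
  rw [ModelWithCorners.range_eq_univ, mfderivWithin_univ, Bundle.Trivialization.symmL_apply] at h'
  · exact h'
  · simpa using (extChartAt (𝓡 n) x₀).map_target hz

theorem contMDiffAt_coordField {x₀ y : M} (hy : y ∈ (extChartAt (𝓡 n) x₀).source) (u : 𝔼) :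
    ContMDiffAt (𝓡 n) ((𝓡 n).prod 𝓘(ℝ, 𝔼)) ∞
      (fun y ↦ Bundle.TotalSpace.mk' 𝔼 y (coordField x₀ u y : TangentSpace (𝓡 n) y)) y := by
  have hy' : y ∈ (trivializationAt 𝔼 (TangentSpace (𝓡 n) : M → Type _) x₀).baseSet := by
    simpa using hy
  rw [(trivializationAt 𝔼 (TangentSpace (𝓡 n) : M → Type _) x₀).contMDiffAt_section_iff hy']
  have : ContMDiffAt (𝓡 n) 𝓘(ℝ, 𝔼) ∞ (fun _ : M ↦ u) y := contMDiffAt_const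
  refine this.congr_of_eventuallyEq ?_
  filter_upwards [(trivializationAt 𝔼 (TangentSpace (𝓡 n) : M → Type _) x₀).open_baseSet.mem_nhds
    hy'] with w hw
  simp [coordField, Bundle.Trivialization.apply_mk_symm _ hw]

theorem diffAt_coordField {x₀ y : M} (hy : y ∈ (extChartAt (𝓡 n) x₀).source) (u : 𝔼) :
    DiffAt (coordField x₀ u) y :=
  (contMDiffAt_coordField hy u).mdifferentiableAt (by simp)

/-- The trivialization at `x₀` reads `X` as its coordinate expression composed with the chart. This
gives the differentiability of fields known only through coordinates, such as `grad f` and `∇_V W`.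
-/
theorem diffAt_of_differentiableAt_localField {x₀ : M} {z : 𝔼}
    (hz : z ∈ (extChartAt (𝓡 n) x₀).target) {X : Π x : M, TangentSpace (𝓡 n) x}
    (hX : DifferentiableAt ℝ (localField x₀ X) z) : DiffAt X ((extChartAt (𝓡 n) x₀).symm z) := by
  have hy := (extChartAt (𝓡 n) x₀).map_target hz
  have hy' : (extChartAt (𝓡 n) x₀).symm z ∈
      (trivializationAt 𝔼 (TangentSpace (𝓡 n) : M → Type _) x₀).baseSet := by
    simpa using hy
  rw [DiffAt, (trivializationAt 𝔼 (TangentSpace (𝓡 n) : M → Type _) x₀).mdifferentiableAt_section_iff _ _ hy']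
  have h1 : MDifferentiableAt (𝓡 n) 𝓘(ℝ, 𝔼) (fun y ↦ localField x₀ X (extChartAt (𝓡 n) x₀ y))
      ((extChartAt (𝓡 n) x₀).symm z) := by
    rw [← (extChartAt (𝓡 n) x₀).right_inv hz] at hX
    exact hX.mdifferentiableAt.comp _ (mdifferentiableAt_extChartAt (by simpa using hy))
  refine h1.congr_of_eventuallyEq ?_
  filter_upwards [(isOpen_extChartAt_source (I := 𝓡 n) x₀).mem_nhds hy] with w hw
  have hw' := (extChartAt (𝓡 n) x₀).map_source hw
  have hb : w ∈ (trivializationAt 𝔼 (TangentSpace (𝓡 n) : M → Type _) x₀).baseSet := by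
    simpa using hw
  have h2 := coordField_symm hw' (localField x₀ X (extChartAt (𝓡 n) x₀ w))
  rw [chartFrame_localField hw', (extChartAt (𝓡 n) x₀).left_inv hw] at h2
  rw [← h2, coordField, Bundle.Trivialization.apply_mk_symm _ hb]

theorem localField_coordField {x₀ : M} {z : 𝔼} (hz : z ∈ (extChartAt (𝓡 n) x₀).target) (u : 𝔼) :
    localField x₀ (coordField x₀ u) z = u := by
  rw [localField, coordField_symm hz, inverse_chartFrame_apply hz]

theorem mvfderiv_chartFrame {x₀ : M} {z : 𝔼} (hz : z ∈ (extChartAt (𝓡 n) x₀).target) {h : M → ℝ}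
    (hh : MDifferentiableAt (𝓡 n) 𝓘(ℝ, ℝ) h ((extChartAt (𝓡 n) x₀).symm z)) (u : 𝔼) :
    mvfderiv (𝓡 n) h ((extChartAt (𝓡 n) x₀).symm z) (chartFrame x₀ z u) =
      fderiv ℝ (h ∘ (extChartAt (𝓡 n) x₀).symm) z u := by
  have := mvfderiv_comp_apply (I' := 𝓡 n) z hh (mdifferentiableAt_symm hz) u
  refine this.symm.trans ?_
  rw [mvfderiv, mfderiv_eq_fderiv]
  rfl

theorem mlieBracket_chart {x₀ : M} {z : 𝔼} (hz : z ∈ (extChartAt (𝓡 n) x₀).target)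
    {X Y : Π x : M, TangentSpace (𝓡 n) x} (hX : DiffAt X ((extChartAt (𝓡 n) x₀).symm z))
    (hY : DiffAt Y ((extChartAt (𝓡 n) x₀).symm z)) :
    VectorField.mlieBracket (𝓡 n) X Y ((extChartAt (𝓡 n) x₀).symm z) =
      chartFrame x₀ z (fderiv ℝ (localField x₀ Y) z (localField x₀ X z)
        - fderiv ℝ (localField x₀ X) z (localField x₀ Y z)) := by
  have := VectorField.mpullback_mlieBracket (n := ∞) hX hY (contMDiffAt_symm hz) (by simp; norm_cast)
  rw [← localField_eq_mpullback, ← localField_eq_mpullback, ← localField_eq_mpullback] at this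
  rw [← chartFrame_localField hz (VectorField.mlieBracket (𝓡 n) X Y), this]
  congr 1
  refine (congrFun (VectorField.mlieBracketWithin_univ (I := 𝓡 n)).symm z).trans ?_
  refine (congrFun VectorField.mlieBracketWithin_eq_lieBracketWithin z).trans ?_
  rw [VectorField.lieBracketWithin_univ]
  rfl

end PseudoRiemannianMetric
end

/-! ### The metric, the gradient and the connections in a chart. -/

noncomputable section

namespace PseudoRiemannianMetric

set_option maxSynthPendingDepth 3
set_option autoImplicit false
set_option linter.unusedSectionVars false

open LocalGeometry

variable {n : ℕ} {M : Type*} [TopologicalSpace M] [ChartedSpace (EuclideanSpace ℝ (Fin n)) M]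
  [IsManifold (𝓡 n) ∞ M]

local notation "𝔼" => EuclideanSpace ℝ (Fin n)

/-- The coordinate expression of a metric in the chart at `x₀`. -/
def localMetric (g : PseudoRiemannianMetric n M) (x₀ : M) (z : 𝔼) : 𝔼 →L[ℝ] 𝔼 →L[ℝ] ℝ :=
  LinearMap.toContinuousBilinearMap <| LinearMap.mk₂ ℝ
    (fun u v ↦ g.inner ((extChartAt (𝓡 n) x₀).symm z) (chartFrame x₀ z u) (chartFrame x₀ z v))
    (by intros; simp only [map_add, add_apply]) (by intros; simp only [map_smul, smul_apply])
    (by intros; simp only [map_add]) (by intros; simp only [map_smul])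

@[simp]
theorem localMetric_apply (g : PseudoRiemannianMetric n M) (x₀ : M) (z u v : 𝔼) :
    g.localMetric x₀ z u v =
      g.inner ((extChartAt (𝓡 n) x₀).symm z) (chartFrame x₀ z u) (chartFrame x₀ z v) := by
  simp [localMetric]

theorem inner_symm_eq_localMetric (g : PseudoRiemannianMetric n M) {x₀ : M} {z : 𝔼}
    (hz : z ∈ (extChartAt (𝓡 n) x₀).target) (X Y : Π x : M, TangentSpace (𝓡 n) x) :
    g.inner ((extChartAt (𝓡 n) x₀).symm z) (X ((extChartAt (𝓡 n) x₀).symm z))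
      (Y ((extChartAt (𝓡 n) x₀).symm z)) =
      g.localMetric x₀ z (localField x₀ X z) (localField x₀ Y z) := by
  rw [localMetric_apply, chartFrame_localField hz, chartFrame_localField hz]

theorem contDiffOn_localMetric (g : PseudoRiemannianMetric n M) (x₀ : M) :
    ContDiffOn ℝ ∞ (g.localMetric x₀) (extChartAt (𝓡 n) x₀).target := by
  rw [contDiffOn_clm_apply]
  intro u
  rw [contDiffOn_clm_apply]
  intro v z hz
  have hy := (extChartAt (𝓡 n) x₀).map_target hz
  have h1 : ContMDiffAt (𝓡 n) 𝓘(ℝ, ℝ) ∞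
      (fun y ↦ g.inner y (coordField x₀ u y) (coordField x₀ v y))
      ((extChartAt (𝓡 n) x₀).symm z) := by
    have := ContMDiffAt.clm_bundle_apply₂ (F₁ := 𝔼) (F₂ := 𝔼) (F₃ := ℝ)
      (E₃ := Bundle.Trivial M ℝ) (b := id) (g.contMDiff _) (contMDiffAt_coordField hy u)
      (contMDiffAt_coordField hy v)
    simp only [Bundle.contMDiffAt_totalSpace] at this
    exact this.2
  have h2 := (h1.comp z (contMDiffAt_symm hz)).contDiffAt
  refine (h2.congr_of_eventuallyEq ?_).contDiffWithinAt
  filter_upwards [(isOpen_target x₀).mem_nhds hz] with w hw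
  simp only [localMetric_apply, Function.comp_apply, coordField_symm hw]

theorem isInvertible_localMetric (g : PseudoRiemannianMetric n M) {x₀ : M} {z : 𝔼}
    (hz : z ∈ (extChartAt (𝓡 n) x₀).target) : (g.localMetric x₀ z).IsInvertible := by
  refine isInvertible_of_nondegenerate fun v hv ↦ ?_
  have h1 : chartFrame x₀ z v = 0 := by
    refine g.nondegenerate _ _ fun w ↦ ?_
    have := hv ((chartFrame x₀ z).inverse w)
    rwa [localMetric_apply, chartFrame_inverse_apply hz] at this
  rw [← inverse_chartFrame_apply hz v, h1, map_zero]

theorem inner_grad (g : PseudoRiemannianMetric n M) (f : M → ℝ) (x : M)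
    (w : TangentSpace (𝓡 n) x) : g.inner x (g.grad f x) w = mvfderiv (𝓡 n) f x w :=
  g.inner_sharp x _ w

theorem gradientData (g : PseudoRiemannianMetric n M) {f : M → ℝ}
    (hf : ContMDiff (𝓡 n) 𝓘(ℝ, ℝ) ∞ f) (x₀ : M) :
    GradientData (extChartAt (𝓡 n) x₀).target (g.localMetric x₀)
      (f ∘ (extChartAt (𝓡 n) x₀).symm) (localField x₀ (g.grad f)) := by
  have hF : ContDiffOn ℝ ∞ (f ∘ (extChartAt (𝓡 n) x₀).symm) (extChartAt (𝓡 n) x₀).target :=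
    fun z hz ↦ ((hf _).comp z (contMDiffAt_symm hz)).contDiffAt.contDiffWithinAt
  have hg : ∀ z ∈ (extChartAt (𝓡 n) x₀).target, ∀ w,
      g.localMetric x₀ z (localField x₀ (g.grad f) z) w =
        fderiv ℝ (f ∘ (extChartAt (𝓡 n) x₀).symm) z w := by
    intro z hz w
    rw [localMetric_apply, chartFrame_localField hz, inner_grad,
      mvfderiv_chartFrame hz ((hf _).mdifferentiableAt (by simp))]
  have hinv : ∀ z ∈ (extChartAt (𝓡 n) x₀).target, (g.localMetric x₀ z).IsInvertible :=
    fun z hz ↦ g.isInvertible_localMetric hz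
  refine ⟨isOpen_target x₀, g.contDiffOn_localMetric x₀, fun z _ u v ↦ ?_, hinv, hF, ?_, hg⟩
  · simp only [localMetric_apply, g.symm]
  -- In coordinates the gradient is `G⁻¹ dF`, hence smooth.
  · refine ((contDiffOn_inverse (g.contDiffOn_localMetric x₀) hinv).clm_apply
      (hF.fderiv_of_isOpen (isOpen_target x₀) (m := ∞) (by simp))).congr fun z hz ↦ ?_
    refine eq_of_apply_eq (hinv z hz) fun w ↦ ?_
    rw [hg z hz, apply_inverse (hinv z hz)]

theorem diffAt_grad (g : PseudoRiemannianMetric n M) {f : M → ℝ}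
    (hf : ContMDiff (𝓡 n) 𝓘(ℝ, ℝ) ∞ f) (x : M) : DiffAt (g.grad f) x := by
  have := diffAt_of_differentiableAt_localField (mem_extChartAt_target (I := 𝓡 n) x)
    ((g.gradientData hf x).differentiableAt_grad (mem_extChartAt_target (I := 𝓡 n) x))
  rwa [(extChartAt (𝓡 n) x).left_inv (mem_extChartAt_source x)] at this

/-- `Γ` are the Christoffel symbols of `D` in the chart at `x₀`. -/
def HasChristoffel (D : AffineConnection n M) (x₀ : M) (Γ : 𝔼 → 𝔼 →L[ℝ] 𝔼 →L[ℝ] 𝔼) : Prop :=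
  ∀ z ∈ (extChartAt (𝓡 n) x₀).target, ∀ Y : Π x : M, TangentSpace (𝓡 n) x,
    DiffAt Y ((extChartAt (𝓡 n) x₀).symm z) → ∀ u : 𝔼,
      D Y ((extChartAt (𝓡 n) x₀).symm z) (chartFrame x₀ z u) =
        chartFrame x₀ z (covDeriv Γ (localField x₀ Y) z u)

theorem localField_coordField_eventuallyEq {x₀ : M} {z : 𝔼}
    (hz : z ∈ (extChartAt (𝓡 n) x₀).target) (u : 𝔼) :
    localField x₀ (coordField x₀ u) =ᶠ[𝓝 z] fun _ ↦ u := by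
  filter_upwards [(isOpen_target x₀).mem_nhds hz] with w hw using localField_coordField hw u

theorem mvfderiv_inner (g : PseudoRiemannianMetric n M) {x₀ : M} {z : 𝔼}
    (hz : z ∈ (extChartAt (𝓡 n) x₀).target) {X Y : Π x : M, TangentSpace (𝓡 n) x}
    (hX : DiffAt X ((extChartAt (𝓡 n) x₀).symm z)) (hY : DiffAt Y ((extChartAt (𝓡 n) x₀).symm z))
    (u : 𝔼) :
    mvfderiv (𝓡 n) (fun y ↦ g.inner y (X y) (Y y)) ((extChartAt (𝓡 n) x₀).symm z)
        (chartFrame x₀ z u) =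
      fderiv ℝ (g.localMetric x₀) z u (localField x₀ X z) (localField x₀ Y z)
      + g.localMetric x₀ z (fderiv ℝ (localField x₀ X) z u) (localField x₀ Y z)
      + g.localMetric x₀ z (localField x₀ X z) (fderiv ℝ (localField x₀ Y) z u) := by
  have dG : DifferentiableAt ℝ (g.localMetric x₀) z :=
    ((g.contDiffOn_localMetric x₀).contDiffAt ((isOpen_target x₀).mem_nhds hz)).differentiableAt
      (by simp)
  have dX := differentiableAt_localField hz hX
  have dY := differentiableAt_localField hz hY
  rw [mvfderiv_chartFrame hz (g.mdifferentiableAt_inner hX hY)]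
  have h1 : ((fun y ↦ g.inner y (X y) (Y y)) ∘ (extChartAt (𝓡 n) x₀).symm) =ᶠ[𝓝 z]
      fun w ↦ g.localMetric x₀ w (localField x₀ X w) (localField x₀ Y w) := by
    filter_upwards [(isOpen_target x₀).mem_nhds hz] with w hw
      using g.inner_symm_eq_localMetric hw X Y
  rw [h1.fderiv_eq, fderiv_clm_apply (dG.clm_apply dX) dY, fderiv_clm_apply dG dX]
  simp
  ring

/-- Koszul's formula is evaluated on coordinate fields `X`, `Z`, whose coordinate derivatives
vanish. The derivatives of `Y` along `w` cancel, those along `u` occur twice, and the three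
derivatives of the metric make up the Christoffel term. -/
theorem hasChristoffel_leviCivita (g : PseudoRiemannianMetric n M) (x₀ : M) :
    HasChristoffel g.leviCivita x₀ (christoffel (g.localMetric x₀)) := by
  intro z hz Y hY u
  have hy := (extChartAt (𝓡 n) x₀).map_target hz
  refine g.ext_inner fun w' ↦ ?_
  obtain ⟨w, rfl⟩ : ∃ w, w' = chartFrame x₀ z w :=
    ⟨(chartFrame x₀ z).inverse w', (chartFrame_inverse_apply hz w').symm⟩
  have hX := diffAt_coordField (x₀ := x₀) hy u
  have hZ := diffAt_coordField (x₀ := x₀) hy w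
  have h1 := g.inner_leviCivitaFun hX hY hZ
  rw [coordField_symm hz, coordField_symm hz] at h1
  change g.inner _ (g.leviCivitaFun Y _ _) _ = _
  rw [h1, ← localMetric_apply]
  have dX : fderiv ℝ (localField x₀ (coordField x₀ u)) z = 0 := by
    rw [(localField_coordField_eventuallyEq hz u).fderiv_eq]; simp
  have dZ : fderiv ℝ (localField x₀ (coordField x₀ w)) z = 0 := by
    rw [(localField_coordField_eventuallyEq hz w).fderiv_eq]; simp
  simp only [koszul]
  rw [mlieBracket_chart hz hX hY, mlieBracket_chart hz hX hZ, mlieBracket_chart hz hY hZ]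
  rw [← chartFrame_localField hz Y, coordField_symm hz, coordField_symm hz]
  rw [g.mvfderiv_inner hz hY hZ, g.mvfderiv_inner hz hX hZ, g.mvfderiv_inner hz hX hY]
  simp only [← localMetric_apply, dX, dZ, localField_coordField hz]
  have hs (a b : 𝔼) : g.localMetric x₀ z a b = g.localMetric x₀ z b a := by
    simp only [localMetric_apply, g.symm]
  have hsD : ∀ a b c, fderiv ℝ (g.localMetric x₀) z a b c = fderiv ℝ (g.localMetric x₀) z a c b :=
    fderiv_metric_symm (((g.contDiffOn_localMetric x₀).contDiffAt
      ((isOpen_target x₀).mem_nhds hz)).differentiableAt (by simp))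
      (.of_forall fun y a b ↦ by simp only [localMetric_apply, g.symm])
  rw [covDeriv_apply, map_add, add_apply, metric_christoffel (g.isInvertible_localMetric hz)]
  simp only [map_zero, zero_apply, sub_zero, zero_sub, map_neg, neg_apply, sub_self, add_zero]
  rw [hs u, hsD u _ w, hsD (localField x₀ Y z) u w]
  ring

theorem hasChristoffel_dfConnection (g : PseudoRiemannianMetric n M) {f : M → ℝ}
    (hf : ContMDiff (𝓡 n) 𝓘(ℝ, ℝ) ∞ f) (x₀ : M) :
    HasChristoffel (g.dfConnection f) x₀ (g.gradientData hf x₀).dfChristoffel := by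
  intro z hz Y hY u
  have h1 := g.hasChristoffel_leviCivita x₀ z hz Y hY u
  change g.leviCivita Y _ _ + g.etaTensor _ _ _ _ = _
  rw [h1]
  simp only [covDeriv_apply, GradientData.dfChristoffel, deformedChristoffel_apply, etaTensor,
    LinearMap.toContinuousBilinearMap_apply, LinearMap.mk₂_apply, map_add, map_smul]
  rw [← chartFrame_localField hz Y, mvfderiv_chartFrame hz ((hf _).mdifferentiableAt (by simp)),
    mvfderiv_chartFrame hz ((hf _).mdifferentiableAt (by simp)), localMetric_apply,
    chartFrame_localField hz (g.grad f)]
  simp only [grad, add_assoc]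

/-- The coordinate frame conjugates the coordinate endomorphism to `∇Y`, and traces are invariant
under conjugation. -/
theorem HasChristoffel.trace_eq {D : AffineConnection n M} {x₀ : M}
    {Γ : 𝔼 → 𝔼 →L[ℝ] 𝔼 →L[ℝ] 𝔼} (h : HasChristoffel D x₀ Γ) {z : 𝔼}
    (hz : z ∈ (extChartAt (𝓡 n) x₀).target) {Y : Π x : M, TangentSpace (𝓡 n) x}
    (hY : DiffAt Y ((extChartAt (𝓡 n) x₀).symm z)) :
    LinearMap.trace ℝ _ (D Y ((extChartAt (𝓡 n) x₀).symm z)).toLinearMap =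
      traceCLM (covDeriv Γ (localField x₀ Y) z) ∧
    LinearMap.trace ℝ _ ((D Y ((extChartAt (𝓡 n) x₀).symm z)).toLinearMap ∘ₗ
      (D Y ((extChartAt (𝓡 n) x₀).symm z)).toLinearMap) =
      traceCLM (covDeriv Γ (localField x₀ Y) z ∘L covDeriv Γ (localField x₀ Y) z) := by
  obtain ⟨e, he⟩ := isInvertible_chartFrame hz
  set B := covDeriv Γ (localField x₀ Y) z
  have h1 (u : 𝔼) : D Y ((extChartAt (𝓡 n) x₀).symm z) (e u) = e (B u) := by
    have := h z hz Y hY u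
    rwa [← he] at this
  have h2 : (D Y ((extChartAt (𝓡 n) x₀).symm z)).toLinearMap =
      e.toLinearEquiv.conj (B : 𝔼 →ₗ[ℝ] 𝔼) := by
    ext v
    obtain ⟨u, rfl⟩ := e.surjective v
    have h3 : B u = B (e.symm (e u)) := by rw [e.symm_apply_apply]
    refine (h1 u).trans ?_
    rw [h3]
    rfl
  rw [h2, ← LinearEquiv.conj_comp, LinearMap.trace_conj', LinearMap.trace_conj']
  exact ⟨rfl, rfl⟩

end PseudoRiemannianMetric
end

/-! ### Curvature, Ricci tensor and scalar products of 2-tensors through coordinates. -/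

noncomputable section

namespace LocalGeometry

set_option maxSynthPendingDepth 3
set_option autoImplicit false

variable {E : Type*} [NormedAddCommGroup E] [NormedSpace ℝ E]

/-- The curvature operator `u ↦ R(u, v)w`. -/
def curvEnd (Γ : E → E →L[ℝ] E →L[ℝ] E) (z v w : E) : E →L[ℝ] E :=
  ((fderiv ℝ Γ z).flip v).flip w - (fderiv ℝ Γ z v).flip w + (Γ z).flip (Γ z v w)
    - Γ z v ∘L (Γ z).flip w

@[simp]
theorem curvEnd_apply (Γ : E → E →L[ℝ] E →L[ℝ] E) (z u v w : E) :
    curvEnd Γ z v w u = curv Γ z u v w := by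
  simp [curvEnd, curv]

/-- The Ricci form of the connection with Christoffel symbols `Γ`. -/
def ricciForm [FiniteDimensional ℝ E] (Γ : E → E →L[ℝ] E →L[ℝ] E) (z : E) :
    LinearMap.BilinForm ℝ E :=
  LinearMap.mk₂ ℝ (fun v w ↦ traceCLM (curvEnd Γ z v w))
    (by intros; rw [← map_add]; congr 1; ext u; simp [curv]; abel)
    (by intros; rw [← map_smul]; congr 1; ext u; simp [curv]; module)
    (by intros; rw [← map_add]; congr 1; ext u; simp [curv]; abel)
    (by intros; rw [← map_smul]; congr 1; ext u; simp [curv]; module)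

open Matrix in
-- As `H` and `A⁻¹` are symmetric, the contraction is the trace of `(H A⁻¹)²`, and `H A⁻¹ = Bᵀ`.
theorem sum_inv_gram_mul {ι : Type*} [Fintype ι] [DecidableEq ι] {A B H : Matrix ι ι ℝ}
    (hA : A.det ≠ 0) (hAt : Aᵀ = A) (hH : H = Bᵀ * A) (hHt : Hᵀ = H) :
    ∑ i, ∑ j, ∑ k, ∑ l, A⁻¹ i k * A⁻¹ j l * H i j * H k l = (B * B).trace := by
  have hAi : (A⁻¹)ᵀ = A⁻¹ := by rw [transpose_nonsing_inv, hAt]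
  have h1 : ∑ i, ∑ j, ∑ k, ∑ l, A⁻¹ i k * A⁻¹ j l * H i j * H k l =
      (H * A⁻¹ * (H * A⁻¹)).trace := by
    have e1 (i k : ι) : (H * A⁻¹ * (H * A⁻¹)) i k =
        ∑ m, ∑ l, ∑ j, H i j * A⁻¹ j l * (H m l * A⁻¹ m k) := by
      rw [Matrix.mul_assoc, ← Matrix.mul_assoc A⁻¹, Matrix.mul_apply]
      have e2 (j : ι) : (A⁻¹ * H * A⁻¹) j k = ∑ m, ∑ l, A⁻¹ j l * (H m l * A⁻¹ m k) := by
        rw [Matrix.mul_apply]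
        refine Finset.sum_congr rfl fun m _ ↦ ?_
        rw [Matrix.mul_apply, Finset.sum_mul]
        refine Finset.sum_congr rfl fun l _ ↦ ?_
        rw [← hHt, transpose_apply, mul_assoc, transpose_apply]
        congr 2
        rw [← transpose_apply H, hHt]
      simp only [e2, Finset.mul_sum]
      rw [Finset.sum_comm]
      refine Finset.sum_congr rfl fun m _ ↦ ?_
      rw [Finset.sum_comm]
      simp only [mul_assoc]
    simp only [Matrix.trace, Matrix.diag, e1]
    refine Finset.sum_congr rfl fun i _ ↦ ?_
    rw [Finset.sum_comm]
    refine Finset.sum_congr rfl fun k _ ↦ ?_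
    rw [Finset.sum_comm]
    refine Finset.sum_congr rfl fun l _ ↦ ?_
    refine Finset.sum_congr rfl fun j _ ↦ ?_
    rw [← congrFun₂ hAi i k, transpose_apply]
    ring
  have hu : IsUnit A.det := isUnit_iff_ne_zero.2 hA
  rw [h1, hH, Matrix.mul_nonsing_inv_cancel_right _ _ hu, ← transpose_mul, trace_transpose]

end LocalGeometry

namespace PseudoRiemannianMetric

set_option maxSynthPendingDepth 3
set_option autoImplicit false
set_option linter.unusedSectionVars false

open LocalGeometry

variable {n : ℕ} {M : Type*} [TopologicalSpace M] [ChartedSpace (EuclideanSpace ℝ (Fin n)) M]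
  [IsManifold (𝓡 n) ∞ M]

local notation "𝔼" => EuclideanSpace ℝ (Fin n)

/-- The trivialization at `x` is the identity on `T_x M`, so a vector at the centre of its chart is
its own coordinate vector. -/
theorem extend_eq_coordField (x : M) (v : TangentSpace (𝓡 n) x) :
    (FiberBundle.extend 𝔼 v : Π y : M, TangentSpace (𝓡 n) y) = coordField x v := by
  have h := TangentBundle.continuousLinearMapAt_trivializationAt (I := 𝓡 n) (x₀ := x) (x := x)
    (by simp)
  rw [mfderiv_extChartAt_self] at h
  have h' := DFunLike.congr_fun h v
  rw [Bundle.Trivialization.continuousLinearMapAt_apply_of_mem _ _ (by simp)] at h'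
  funext y
  exact congrArg ((trivializationAt 𝔼 (TangentSpace (𝓡 n)) x).symm y) h'

theorem coordField_self (x : M) (v : TangentSpace (𝓡 n) x) : coordField x v x = v := by
  rw [← extend_eq_coordField, FiberBundle.extend_apply_self]

theorem HasChristoffel.apply_coordField {D : AffineConnection n M} {x₀ : M}
    {Γ : 𝔼 → 𝔼 →L[ℝ] 𝔼 →L[ℝ] 𝔼} (h : HasChristoffel D x₀ Γ) {y : M}
    (hy : y ∈ (extChartAt (𝓡 n) x₀).source) {Y : Π x : M, TangentSpace (𝓡 n) x} (hY : DiffAt Y y)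
    (u : 𝔼) : D Y y (coordField x₀ u y) =
      coordField x₀ (covDeriv Γ (localField x₀ Y) (extChartAt (𝓡 n) x₀ y) u) y := by
  obtain ⟨z, hz, rfl⟩ : ∃ z ∈ (extChartAt (𝓡 n) x₀).target, (extChartAt (𝓡 n) x₀).symm z = y :=
    ⟨_, (extChartAt (𝓡 n) x₀).map_source hy, (extChartAt (𝓡 n) x₀).left_inv hy⟩
  rw [coordField_symm hz, coordField_symm hz, h z hz Y hY, (extChartAt (𝓡 n) x₀).right_inv hz]

theorem mlieBracket_coordField (x : M) (u v : 𝔼) :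
    VectorField.mlieBracket (𝓡 n) (coordField x u) (coordField x v) x = 0 := by
  have hx := mem_extChartAt_source (I := 𝓡 n) x
  have hz := mem_extChartAt_target (I := 𝓡 n) x
  have hy := (extChartAt (𝓡 n) x).map_target hz
  have h := mlieBracket_chart hz (diffAt_coordField hy u) (diffAt_coordField hy v)
  rw [(localField_coordField_eventuallyEq hz u).fderiv_eq,
    (localField_coordField_eventuallyEq hz v).fderiv_eq] at h
  simp only [fderiv_const_apply, zero_apply, sub_self, map_zero] at h
  rwa [(extChartAt (𝓡 n) x).left_inv hx] at h

theorem covDeriv_coordField {x₀ : M} (Γ : 𝔼 → 𝔼 →L[ℝ] 𝔼 →L[ℝ] 𝔼) {z : 𝔼}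
    (hz : z ∈ (extChartAt (𝓡 n) x₀).target) (u w : 𝔼) :
    covDeriv Γ (localField x₀ (coordField x₀ w)) z u = Γ z u w := by
  rw [covDeriv_apply, (localField_coordField_eventuallyEq hz w).fderiv_eq,
    localField_coordField hz]
  simp

/-- Throughout the chart `∇_V W` has coordinate expression `Γ(v, w)`; one more covariant derivative
gives a derivative of `Γ` and a quadratic term. -/
theorem HasChristoffel.iterated {D : AffineConnection n M} {x : M}
    {Γ : 𝔼 → 𝔼 →L[ℝ] 𝔼 →L[ℝ] 𝔼} (h : HasChristoffel D x Γ)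
    (hΓ : ContDiffOn ℝ ∞ Γ (extChartAt (𝓡 n) x).target) (u v w : 𝔼) :
    D (fun y ↦ D (coordField x w) y (coordField x v y)) x u =
      fderiv ℝ Γ (extChartAt (𝓡 n) x x) u v w +
        Γ (extChartAt (𝓡 n) x x) u (Γ (extChartAt (𝓡 n) x x) v w) := by
  have hx := mem_extChartAt_source (I := 𝓡 n) x
  have hz := mem_extChartAt_target (I := 𝓡 n) x
  have dΓ : DifferentiableAt ℝ Γ (extChartAt (𝓡 n) x x) :=
    (hΓ.contDiffAt ((isOpen_target x).mem_nhds hz)).differentiableAt (by simp)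
  set Y : Π y : M, TangentSpace (𝓡 n) y := fun y ↦ D (coordField x w) y (coordField x v y)
  have h1 {z : 𝔼} (hz : z ∈ (extChartAt (𝓡 n) x).target) : localField x Y z = Γ z v w := by
    have hy := (extChartAt (𝓡 n) x).map_target hz
    simp only [localField, Y]
    rw [coordField_symm hz, h z hz _ (diffAt_coordField hy w), covDeriv_coordField Γ hz,
      inverse_chartFrame_apply hz]
  have h2 : localField x Y =ᶠ[𝓝 (extChartAt (𝓡 n) x x)] fun z ↦ Γ z v w := by
    filter_upwards [(isOpen_target x).mem_nhds hz] with y hy using h1 hy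
  -- `HasChristoffel` speaks only of differentiable fields, so this must be known before `∇_V W` is
  -- differentiated.
  have h3 : DiffAt Y x := by
    have h4 : DifferentiableAt ℝ (fun z ↦ Γ z v w) (extChartAt (𝓡 n) x x) := by fun_prop
    have h5 := diffAt_of_differentiableAt_localField hz (X := Y)
      (h4.congr_of_eventuallyEq h2)
    rwa [(extChartAt (𝓡 n) x).left_inv hx] at h5
  have h6 := h.apply_coordField hx h3 u
  rw [coordField_self x u, covDeriv_apply, h2.fderiv_eq, h1 hz] at h6
  refine h6.trans ((coordField_self x _).trans ?_)
  rw [fderiv_clm_apply (by fun_prop) (by fun_prop), fderiv_clm_apply dΓ (by fun_prop)]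
  simp
  rfl

theorem HasChristoffel.curvature_eq {D : AffineConnection n M} {x : M}
    {Γ : 𝔼 → 𝔼 →L[ℝ] 𝔼 →L[ℝ] 𝔼} (h : HasChristoffel D x Γ)
    (hΓ : ContDiffOn ℝ ∞ Γ (extChartAt (𝓡 n) x).target) (u v w : TangentSpace (𝓡 n) x) :
    curvature D x u v w = curvEnd Γ (extChartAt (𝓡 n) x x) v w u := by
  refine Eq.trans ?_ (curvEnd_apply (E := 𝔼) ..).symm
  simp only [curvature, extend_eq_coordField]
  have h1 := mlieBracket_coordField x u v
  rw [h1, map_zero, sub_zero]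
  have h2 := h.iterated hΓ u v w
  have h3 := h.iterated hΓ v u w
  refine (congrArg₂ (fun a b : 𝔼 ↦ a - b) h2 h3).trans ?_
  have key (a b c d : 𝔼) : a + b - (c + d) = a - c + b - d := by abel
  exact key _ _ _ _

theorem HasChristoffel.ricci_eq {D : AffineConnection n M} {x : M}
    {Γ : 𝔼 → 𝔼 →L[ℝ] 𝔼 →L[ℝ] 𝔼} (h : HasChristoffel D x Γ)
    (hΓ : ContDiffOn ℝ ∞ Γ (extChartAt (𝓡 n) x).target) (v w : TangentSpace (𝓡 n) x) :
    ricci D x v w = traceCLM (curvEnd Γ (extChartAt (𝓡 n) x x) v w) := by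
  rw [traceCLM_apply,
    LinearMap.trace_eq_matrix_trace ℝ (EuclideanSpace.basisFun (Fin n) ℝ).toBasis]
  simp only [ricci, h.curvature_eq hΓ, Matrix.trace, Matrix.diag, LinearMap.toMatrix_apply]
  rfl

/-- The definition of `ricci` by extensions does not display its bilinearity, which the contraction
in `innerTensor_mul` requires. -/
theorem HasChristoffel.exists_ricci_bilin {D : AffineConnection n M} {x : M}
    {Γ : 𝔼 → 𝔼 →L[ℝ] 𝔼 →L[ℝ] 𝔼} (h : HasChristoffel D x Γ)
    (hΓ : ContDiffOn ℝ ∞ Γ (extChartAt (𝓡 n) x).target) :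
    ∃ R : LinearMap.BilinForm ℝ (TangentSpace (𝓡 n) x), ∀ v w, ricci D x v w = R v w :=
  ⟨ricciForm Γ (extChartAt (𝓡 n) x x), fun v w ↦ h.ricci_eq hΓ v w⟩

theorem det_gram_ne_zero (g : PseudoRiemannianMetric n M) (x : M) : (g.gram x).det ≠ 0 := by
  have := (LinearMap.BilinForm.nondegenerate_iff_det_ne_zero (B := g.bilin x) (tangentBasis x)).1
    (g.bilin_nondegenerate x)
  convert this
  ext i j
  simp [gram, bilin, LinearMap.BilinForm.toMatrix_apply]

theorem gram_transpose (g : PseudoRiemannianMetric n M) (x : M) :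
    (g.gram x).transpose = g.gram x := by
  ext i j
  simp [gram, g.symm x (tangentBasis x i)]

/-- Raising an index of the form `g(B·, ·)` recovers `B`, so with `B` self-adjoint the squared norm
is `tr B²`. No positivity is involved. -/
theorem innerTensor_self (g : PseudoRiemannianMetric n M) (x : M)
    (B : TangentSpace (𝓡 n) x →ₗ[ℝ] TangentSpace (𝓡 n) x)
    (hB : ∀ u v, g.inner x (B u) v = g.inner x (B v) u) :
    g.innerTensor x (fun u v ↦ g.inner x (B u) v) (fun u v ↦ g.inner x (B u) v) =
      LinearMap.trace ℝ _ (B ∘ₗ B) := by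
  set b := tangentBasis (n := n) x
  set C := LinearMap.toMatrix b b B with hC
  have h1 (i : Fin n) : B (b i) = ∑ k, C k i • b k := by
    simp only [hC, LinearMap.toMatrix_apply]
    exact (b.sum_repr _).symm
  rw [LinearMap.trace_eq_matrix_trace ℝ b, LinearMap.toMatrix_comp b b b, ← hC,
    ← sum_inv_gram_mul (g.det_gram_ne_zero x) (g.gram_transpose x)
      (H := Matrix.of fun i j ↦ g.inner x (B (b i)) (b j)) ?_ ?_]
  · rfl
  · ext i j
    simp only [Matrix.of_apply, h1, map_sum, map_smul, sum_apply, smul_apply, smul_eq_mul,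
      Matrix.mul_apply, Matrix.transpose_apply]
    rfl
  · ext i j
    simp [hB (b i)]

theorem innerTensor_mul (g : PseudoRiemannianMetric n M) (x : M)
    (R : LinearMap.BilinForm ℝ (TangentSpace (𝓡 n) x)) (α : TangentSpace (𝓡 n) x →L[ℝ] ℝ) :
    g.innerTensor x (fun u v ↦ R u v) (fun u v ↦ α u * α v) = R (g.sharp x α) (g.sharp x α) := by
  set b := tangentBasis (n := n) x
  have hu : IsUnit (g.gram x).det := isUnit_iff_ne_zero.2 (g.det_gram_ne_zero x)
  -- The components of `α^♯` are `g^{ik} α_k`: pairing `α^♯` with the basis gives a linear system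
  -- with the Gram matrix, which is then inverted.
  have h1 : g.sharp x α = ∑ i, (∑ k, (g.gram x)⁻¹ i k * α (b k)) • b i := by
    have h2 (k : Fin n) : α (b k) = ∑ m, b.repr (g.sharp x α) m * g.gram x m k := by
      rw [← g.inner_sharp x α (b k)]
      conv_lhs => rw [← b.sum_repr (g.sharp x α)]
      simp only [map_sum, map_smul, sum_apply, smul_apply, smul_eq_mul]
      rfl
    conv_lhs => rw [← b.sum_repr (g.sharp x α)]
    refine Finset.sum_congr rfl fun i _ ↦ ?_
    congr 1
    have h3 : ((g.gram x)⁻¹ * (g.gram x)).mulVec (b.repr (g.sharp x α)) i =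
        b.repr (g.sharp x α) i := by
      rw [Matrix.nonsing_inv_mul _ hu, Matrix.one_mulVec]
    rw [← h3, ← Matrix.mulVec_mulVec, Matrix.mulVec, dotProduct]
    refine Finset.sum_congr rfl fun k _ ↦ ?_
    rw [h2 k, Matrix.mulVec, dotProduct]
    congr 1
    refine Finset.sum_congr rfl fun m _ ↦ ?_
    rw [← g.gram_transpose, Matrix.transpose_apply, mul_comm, g.gram_transpose]
  set a : Fin n → ℝ := fun i ↦ ∑ k, (g.gram x)⁻¹ i k * α (b k)
  have h2 : R (g.sharp x α) (g.sharp x α) = ∑ i, ∑ j, a i * a j * R (b i) (b j) := by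
    rw [h1, Finset.sum_comm]
    simp only [map_sum, LinearMap.sum_apply, map_smul, LinearMap.smul_apply, smul_eq_mul,
      Finset.mul_sum]
    exact Finset.sum_congr rfl fun i _ ↦ Finset.sum_congr rfl fun j _ ↦ by ring
  rw [h2]
  refine Finset.sum_congr rfl fun i _ ↦ Finset.sum_congr rfl fun j _ ↦ ?_
  rw [Finset.sum_mul_sum, Finset.sum_mul]
  refine Finset.sum_congr rfl fun k _ ↦ ?_
  rw [Finset.sum_mul]
  exact Finset.sum_congr rfl fun l _ ↦ by ring

end PseudoRiemannianMetric
end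

/-! ### Smoothness of the integrands and the pointwise identities. -/

noncomputable section

namespace PseudoRiemannianMetric

set_option maxSynthPendingDepth 3
set_option autoImplicit false
set_option linter.unusedSectionVars false

open LocalGeometry

variable {n : ℕ} {M : Type*} [TopologicalSpace M] [ChartedSpace (EuclideanSpace ℝ (Fin n)) M]
  [IsManifold (𝓡 n) ∞ M]

local notation "𝔼" => EuclideanSpace ℝ (Fin n)

theorem exists_mem_target (x : M) :
    ∃ z ∈ (extChartAt (𝓡 n) x).target, (extChartAt (𝓡 n) x).symm z = x :=
  ⟨_, mem_extChartAt_target x, (extChartAt (𝓡 n) x).left_inv (mem_extChartAt_source x)⟩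

theorem contMDiff_of_contDiffOn_charts {h : M → ℝ}
    (H : ∀ x : M, ContDiffOn ℝ ∞ (h ∘ (extChartAt (𝓡 n) x).symm) (extChartAt (𝓡 n) x).target) :
    ContMDiff (𝓡 n) 𝓘(ℝ, ℝ) ∞ h := by
  intro x
  have h1 := ((H x).contDiffAt ((isOpen_target x).mem_nhds (mem_extChartAt_target x))).contMDiffAt
  have h2 := h1.comp x (contMDiffAt_extChartAt (I := 𝓡 n) (n := ∞) (x := x))
  refine h2.congr_of_eventuallyEq ?_
  filter_upwards [(isOpen_extChartAt_source (I := 𝓡 n) x).mem_nhds (mem_extChartAt_source x)]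
    with y hy
  simp only [Function.comp_apply, (extChartAt (𝓡 n) x).left_inv hy]

theorem contDiffOn_comp_symm {h : M → ℝ} (hh : ContMDiff (𝓡 n) 𝓘(ℝ, ℝ) ∞ h) (x : M) :
    ContDiffOn ℝ ∞ (h ∘ (extChartAt (𝓡 n) x).symm) (extChartAt (𝓡 n) x).target :=
  fun z hz ↦ ((hh _).comp z (contMDiffAt_symm hz)).contDiffAt.contDiffWithinAt

variable (g : PseudoRiemannianMetric n M) {f : M → ℝ} (hf : ContMDiff (𝓡 n) 𝓘(ℝ, ℝ) ∞ f)

include hf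

theorem mvfderiv_grad_symm {h : M → ℝ} (hh : ContMDiff (𝓡 n) 𝓘(ℝ, ℝ) ∞ h) {x₀ : M} {z : 𝔼}
    (hz : z ∈ (extChartAt (𝓡 n) x₀).target) :
    mvfderiv (𝓡 n) h ((extChartAt (𝓡 n) x₀).symm z) (g.grad f ((extChartAt (𝓡 n) x₀).symm z)) =
      fderiv ℝ (h ∘ (extChartAt (𝓡 n) x₀).symm) z (localField x₀ (g.grad f) z) := by
  rw [← mvfderiv_chartFrame hz ((hh _).mdifferentiableAt (by simp)), chartFrame_localField hz]

theorem contMDiff_mvfderiv_grad {h : M → ℝ} (hh : ContMDiff (𝓡 n) 𝓘(ℝ, ℝ) ∞ h) :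
    ContMDiff (𝓡 n) 𝓘(ℝ, ℝ) ∞ (fun x ↦ mvfderiv (𝓡 n) h x (g.grad f x)) := by
  refine contMDiff_of_contDiffOn_charts fun x ↦ ?_
  refine (((contDiffOn_comp_symm hh x).fderiv_of_isOpen (isOpen_target x) (m := ∞)
    (by simp)).clm_apply (g.gradientData hf x).contDiffOn_grad).congr fun z hz ↦ ?_
  exact g.mvfderiv_grad_symm hf hh hz

theorem laplacian_symm {D : AffineConnection n M} {x₀ : M} {Γ : 𝔼 → 𝔼 →L[ℝ] 𝔼 →L[ℝ] 𝔼}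
    (h : HasChristoffel D x₀ Γ) {z : 𝔼} (hz : z ∈ (extChartAt (𝓡 n) x₀).target) :
    g.laplacian D f ((extChartAt (𝓡 n) x₀).symm z) =
      traceCLM (covDeriv Γ (localField x₀ (g.grad f)) z) :=
  (h.trace_eq hz (g.diffAt_grad hf _)).1

theorem contMDiff_laplacian {D : AffineConnection n M} {Γ : M → 𝔼 → 𝔼 →L[ℝ] 𝔼 →L[ℝ] 𝔼}
    (h : ∀ x, HasChristoffel D x (Γ x))
    (hΓ : ∀ x, ContDiffOn ℝ ∞ (Γ x) (extChartAt (𝓡 n) x).target) :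
    ContMDiff (𝓡 n) 𝓘(ℝ, ℝ) ∞ (g.laplacian D f) := by
  refine contMDiff_of_contDiffOn_charts fun x ↦ ?_
  refine (traceCLM.contDiff.comp_contDiffOn (contDiffOn_covDeriv (isOpen_target x) (hΓ x)
    (g.gradientData hf x).contDiffOn_grad)).congr fun z hz ↦ ?_
  exact g.laplacian_symm hf (h x) hz

theorem contMDiff_trace_comp {D : AffineConnection n M} {Γ : M → 𝔼 → 𝔼 →L[ℝ] 𝔼 →L[ℝ] 𝔼}
    (h : ∀ x, HasChristoffel D x (Γ x))
    (hΓ : ∀ x, ContDiffOn ℝ ∞ (Γ x) (extChartAt (𝓡 n) x).target) :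
    ContMDiff (𝓡 n) 𝓘(ℝ, ℝ) ∞ (fun x ↦ LinearMap.trace ℝ (TangentSpace (𝓡 n) x)
      ((D (g.grad f) x).toLinearMap ∘ₗ (D (g.grad f) x).toLinearMap)) := by
  refine contMDiff_of_contDiffOn_charts fun x ↦ ?_
  have h1 := contDiffOn_covDeriv (isOpen_target x) (hΓ x)
    (g.gradientData hf x).contDiffOn_grad
  refine (traceCLM.contDiff.comp_contDiffOn (h1.clm_comp h1)).congr fun z hz ↦ ?_
  exact ((h x).trace_eq hz (g.diffAt_grad hf _)).2

theorem contMDiff_laplacian_leviCivita :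
    ContMDiff (𝓡 n) 𝓘(ℝ, ℝ) ∞ (g.laplacian g.leviCivita f) :=
  g.contMDiff_laplacian hf g.hasChristoffel_leviCivita
    fun x ↦ (g.gradientData hf x).contDiffOn_christoffel

theorem contMDiff_laplacian_dfConnection :
    ContMDiff (𝓡 n) 𝓘(ℝ, ℝ) ∞ (g.laplacian (g.dfConnection f) f) :=
  g.contMDiff_laplacian hf (g.hasChristoffel_dfConnection hf)
    fun x ↦ (g.gradientData hf x).contDiffOn_dfChristoffel

theorem hess_leviCivita_symm (x : M) (u v : TangentSpace (𝓡 n) x) :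
    g.hess g.leviCivita f x u v = g.hess g.leviCivita f x v u := by
  obtain ⟨z, hz, hx⟩ := exists_mem_target (n := n) x
  have key (u v : TangentSpace (𝓡 n) ((extChartAt (𝓡 n) x).symm z)) :
      g.hess g.leviCivita f ((extChartAt (𝓡 n) x).symm z) u v =
        g.hess g.leviCivita f ((extChartAt (𝓡 n) x).symm z) v u := by
    rw [← chartFrame_inverse_apply hz u, ← chartFrame_inverse_apply hz v]
    simp only [hess]
    rw [g.hasChristoffel_leviCivita x z hz _ (g.diffAt_grad hf _),
      g.hasChristoffel_leviCivita x z hz _ (g.diffAt_grad hf _), ← localMetric_apply,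
      ← localMetric_apply, (g.gradientData hf x).metric_covDeriv_symm hz]
  rw [hx] at key
  exact key u v

theorem hess_dfConnection (x : M) (u v : TangentSpace (𝓡 n) x) :
    g.hess (g.dfConnection f) f x u v = g.hess g.leviCivita f x u v +
      2 * (mvfderiv (𝓡 n) f x u * mvfderiv (𝓡 n) f x v) +
      g.inner x (g.grad f x) (g.grad f x) * g.inner x u v := by
  have h1 : g.dfConnection f (g.grad f) x u = g.leviCivita (g.grad f) x u +
    (mvfderiv (𝓡 n) f x u • g.grad f x + mvfderiv (𝓡 n) f x (g.grad f x) • u +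
      g.inner x u (g.grad f x) • g.sharp x (mvfderiv (𝓡 n) f x)) := rfl
  rw [hess, h1, g.symm x u]
  change g.inner x (_ + (_ + _ + _ • g.grad f x)) v = _
  simp only [map_add, add_apply, map_smul, smul_apply, inner_grad, hess, smul_eq_mul]
  ring

theorem hess_dfConnection_symm (x : M) (u v : TangentSpace (𝓡 n) x) :
    g.hess (g.dfConnection f) f x u v = g.hess (g.dfConnection f) f x v u := by
  rw [g.hess_dfConnection hf, g.hess_dfConnection hf, g.hess_leviCivita_symm hf x u, g.symm x u v]
  ring

theorem innerTensor_hess_leviCivita (x : M) :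
    g.innerTensor x (g.hess g.leviCivita f x) (g.hess g.leviCivita f x) =
      LinearMap.trace ℝ (TangentSpace (𝓡 n) x)
        ((g.leviCivita (g.grad f) x).toLinearMap ∘ₗ (g.leviCivita (g.grad f) x).toLinearMap) :=
  g.innerTensor_self x (g.leviCivita (g.grad f) x).toLinearMap (g.hess_leviCivita_symm hf x)

theorem innerTensor_hess_dfConnection (x : M) :
    g.innerTensor x (g.hess (g.dfConnection f) f x) (g.hess (g.dfConnection f) f x) =
      LinearMap.trace ℝ (TangentSpace (𝓡 n) x)
        ((g.dfConnection f (g.grad f) x).toLinearMap ∘ₗ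
          (g.dfConnection f (g.grad f) x).toLinearMap) :=
  g.innerTensor_self x (g.dfConnection f (g.grad f) x).toLinearMap (g.hess_dfConnection_symm hf x)

theorem innerTensor_ricci_dfConnection (x : M) :
    g.innerTensor x (ricci (g.dfConnection f) x)
      (fun u v ↦ mvfderiv (𝓡 n) f x u * mvfderiv (𝓡 n) f x v) =
      ricci (g.dfConnection f) x (g.grad f x) (g.grad f x) := by
  obtain ⟨R, hR⟩ := (g.hasChristoffel_dfConnection hf x).exists_ricci_bilin
    (g.gradientData hf x).contDiffOn_dfChristoffel
  rw [hR, ← show (fun u v ↦ R u v) = ricci (g.dfConnection f) x from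
    (funext fun u ↦ funext fun v ↦ (hR u v).symm)]
  exact g.innerTensor_mul x R _

variable {c : ℝ} (hc : ∀ x, g.inner x (g.grad f x) (g.grad f x) = c)

include hc

theorem localMetric_grad {x₀ : M} : ∀ z ∈ (extChartAt (𝓡 n) x₀).target,
    g.localMetric x₀ z (localField x₀ (g.grad f) z) (localField x₀ (g.grad f) z) = c := by
  intro z hz
  rw [← g.inner_symm_eq_localMetric hz, hc]

/-- The Bochner formula for `∇^{df}`. -/
theorem ricci_dfConnection_grad (x : M) :
    ricci (g.dfConnection f) x (g.grad f x) (g.grad f x) =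
      3 * c * g.laplacian (g.dfConnection f) f x -
      g.innerTensor x (g.hess (g.dfConnection f) f x) (g.hess (g.dfConnection f) f x) -
      mvfderiv (𝓡 n) (g.laplacian (g.dfConnection f) f) x (g.grad f x) := by
  have hz := mem_extChartAt_target (I := 𝓡 n) x
  have hx := (extChartAt (𝓡 n) x).left_inv (mem_extChartAt_source x)
  have hΓ := g.hasChristoffel_dfConnection hf x
  have hd := g.gradientData hf x
  -- At the centre of its own chart, the coordinate vector of `grad f` is `grad f` itself.
  have h0 : localField x (g.grad f) (extChartAt (𝓡 n) x x) = g.grad f x := by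
    have h1 := coordField_symm hz (localField x (g.grad f) (extChartAt (𝓡 n) x x))
    rw [chartFrame_localField hz, hx] at h1
    rw [← h1]
    exact (coordField_self x _).symm
  have h1 := hd.traceCLM_curv_dfChristoffel (g.localMetric_grad hf hc) hz (curvEnd_apply _ _ · _ _)
  rw [h0] at h1
  rw [g.innerTensor_hess_dfConnection hf]
  refine (hΓ.ricci_eq hd.contDiffOn_dfChristoffel _ _).trans (h1.trans ?_)
  have h2 := g.laplacian_symm hf hΓ hz
  have h3 := (hΓ.trace_eq hz (g.diffAt_grad hf _)).2
  have h4 := g.mvfderiv_grad_symm hf (g.contMDiff_laplacian_dfConnection hf) hz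
  have h5 : (g.laplacian (g.dfConnection f) f ∘ (extChartAt (𝓡 n) x).symm)
      =ᶠ[𝓝 (extChartAt (𝓡 n) x x)] fun y ↦
        traceCLM (covDeriv hd.dfChristoffel (localField x (g.grad f)) y) := by
    filter_upwards [(isOpen_target x).mem_nhds hz] with y hy using g.laplacian_symm hf hΓ hy
  rw [h5.fderiv_eq, h0] at h4
  rw [hx] at h2 h3 h4
  rw [h2, h3, h4]

theorem laplacian_dfConnection (x : M) :
    g.laplacian (g.dfConnection f) f x = g.laplacian g.leviCivita f x + (n + 2) * c := by
  obtain ⟨z, hz, hx⟩ := exists_mem_target (n := n) x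
  have h1 := (g.gradientData hf x).traceCLM_covDeriv_dfChristoffel (g.localMetric_grad hf hc) hz
  rw [← g.laplacian_symm hf (g.hasChristoffel_dfConnection hf x) hz,
    ← g.laplacian_symm hf (g.hasChristoffel_leviCivita x) hz, hx] at h1
  simpa using h1

theorem innerTensor_hess_dfConnection_eq (x : M) :
    g.innerTensor x (g.hess (g.dfConnection f) f x) (g.hess (g.dfConnection f) f x) =
      g.innerTensor x (g.hess g.leviCivita f x) (g.hess g.leviCivita f x) +
      2 * c * g.laplacian g.leviCivita f x + (n + 8) * c ^ 2 := by
  obtain ⟨z, hz, hx⟩ := exists_mem_target (n := n) x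
  have h1 := (g.gradientData hf x).traceCLM_covDeriv_dfChristoffel_comp
    (g.localMetric_grad hf hc) hz
  rw [← g.laplacian_symm hf (g.hasChristoffel_leviCivita x) hz,
    ← ((g.hasChristoffel_dfConnection hf x).trace_eq hz (g.diffAt_grad hf _)).2,
    ← ((g.hasChristoffel_leviCivita x).trace_eq hz (g.diffAt_grad hf _)).2, hx] at h1
  rw [g.innerTensor_hess_leviCivita hf, g.innerTensor_hess_dfConnection hf]
  simpa using h1

theorem mvfderiv_laplacian_dfConnection (x : M) :
    mvfderiv (𝓡 n) (g.laplacian (g.dfConnection f) f) x =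
      mvfderiv (𝓡 n) (g.laplacian g.leviCivita f) x := by
  have h1 : g.laplacian (g.dfConnection f) f =
      g.laplacian g.leviCivita f + fun _ ↦ (n + 2) * c :=
    funext fun x ↦ g.laplacian_dfConnection hf hc x
  rw [h1, mvfderiv_add (((g.contMDiff_laplacian_leviCivita hf) x).mdifferentiableAt (by simp))
    mdifferentiableAt_const, mvfderiv_const, add_zero]

/-- The pointwise identity behind the first volume formula. -/
theorem hess_leviCivita_add_ricci (x : M) :
    g.innerTensor x (g.hess g.leviCivita f x) (g.hess g.leviCivita f x) +
      mvfderiv (𝓡 n) (g.laplacian g.leviCivita f) x (g.grad f x) +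
      g.innerTensor x (ricci (g.dfConnection f) x)
        (fun u v ↦ mvfderiv (𝓡 n) f x u * mvfderiv (𝓡 n) f x v) =
      c * g.laplacian g.leviCivita f x + 2 * (n - 1) * c ^ 2 := by
  rw [g.innerTensor_ricci_dfConnection hf, g.ricci_dfConnection_grad hf hc,
    g.innerTensor_hess_dfConnection_eq hf hc, g.laplacian_dfConnection hf hc,
    g.mvfderiv_laplacian_dfConnection hf hc]
  -- The coefficients come from `3c − 2c = c` and `3(n+2) − (n+8) = 2(n−1)`.
  ring

/-- The pointwise identity behind the second volume formula. -/
theorem hess_dfConnection_add_ricci (x : M) :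
    g.innerTensor x (g.hess (g.dfConnection f) f x) (g.hess (g.dfConnection f) f x) +
      mvfderiv (𝓡 n) (g.laplacian (g.dfConnection f) f) x (g.grad f x) +
      ricci (g.dfConnection f) x (g.grad f x) (g.grad f x) =
      3 * c * g.laplacian g.leviCivita f x + 3 * (n + 2) * c ^ 2 := by
  -- The Bochner formula cancels the Hessian and derivative terms and leaves `3c Δ^{df} f`.
  rw [g.ricci_dfConnection_grad hf hc, g.laplacian_dfConnection hf hc]
  ring

end PseudoRiemannianMetric
end

/-! ### The volume measure: independence of charts, local finiteness, integrals in a chart. -/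

noncomputable section

namespace PseudoRiemannianMetric

set_option maxSynthPendingDepth 3
set_option autoImplicit false
set_option linter.unusedSectionVars false

open LocalGeometry

variable {n : ℕ} {M : Type*} [TopologicalSpace M] [ChartedSpace (EuclideanSpace ℝ (Fin n)) M]
  [IsManifold (𝓡 n) ∞ M]

local notation "𝔼" => EuclideanSpace ℝ (Fin n)

theorem chartDensity_eq (g : PseudoRiemannianMetric n M) (x : M) (z : 𝔼) :
    g.chartDensity x z =
      √|GradientData.gramDet (g.localMetric x) (EuclideanSpace.basisFun (Fin n) ℝ).toBasis z| := by
  simp only [GradientData.gramDet, localMetric_apply, OrthonormalBasis.coe_toBasis]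
  rfl

theorem chartDensity_nonneg (g : PseudoRiemannianMetric n M) (x : M) (z : 𝔼) :
    0 ≤ g.chartDensity x z := Real.sqrt_nonneg _

theorem hasFDerivAt_chartDensity (g : PseudoRiemannianMetric n M) {x : M} {z : 𝔼}
    (hz : z ∈ (extChartAt (𝓡 n) x).target) :
    HasFDerivAt (g.chartDensity x)
      (g.chartDensity x z • (traceCLM ∘L christoffel (g.localMetric x) z)) z := by
  -- The density depends on the metric alone; the zero function only supplies a `GradientData`.
  have h := (g.gradientData (f := fun _ ↦ 0) contMDiff_const x).hasFDerivAt_sqrt_gramDet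
    (EuclideanSpace.basisFun (Fin n) ℝ).toBasis hz
  rw [← g.chartDensity_eq] at h
  exact h.congr_of_eventuallyEq (.of_forall fun y ↦ g.chartDensity_eq x y)

theorem continuousOn_chartDensity (g : PseudoRiemannianMetric n M) (x : M) :
    ContinuousOn (g.chartDensity x) (extChartAt (𝓡 n) x).target :=
  fun _ hz ↦ (g.hasFDerivAt_chartDensity hz).continuousAt.continuousWithinAt

/-- The change of coordinates between the charts at `x` and at `y`. -/
def transition (x y : M) : 𝔼 → 𝔼 := extChartAt (𝓡 n) y ∘ (extChartAt (𝓡 n) x).symm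

theorem differentiableAt_transition {x y : M} {z : 𝔼} (hz : z ∈ (extChartAt (𝓡 n) x).target)
    (hy : (extChartAt (𝓡 n) x).symm z ∈ (extChartAt (𝓡 n) y).source) :
    DifferentiableAt ℝ (transition x y : 𝔼 → 𝔼) z := by
  rw [← mdifferentiableAt_iff_differentiableAt]
  exact (mdifferentiableAt_extChartAt (by simpa using hy)).comp z (mdifferentiableAt_symm hz)

theorem chartFrame_eq_comp {x y : M} {z : 𝔼} (hz : z ∈ (extChartAt (𝓡 n) x).target)
    (hy : (extChartAt (𝓡 n) x).symm z ∈ (extChartAt (𝓡 n) y).source) (u : 𝔼) :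
    (chartFrame x z u : 𝔼) =
      (chartFrame y (transition x y z) (fderiv ℝ (transition x y) z u) : 𝔼) := by
  have h1 : (extChartAt (𝓡 n) x).symm =ᶠ[𝓝 z] (extChartAt (𝓡 n) y).symm ∘ transition x y := by
    have := (continuousAt_extChartAt_symm'' (I := 𝓡 n) hz).preimage_mem_nhds
      ((isOpen_extChartAt_source (I := 𝓡 n) y).mem_nhds hy)
    filter_upwards [this] with w hw
    exact ((extChartAt (𝓡 n) y).left_inv hw).symm
  have h2 := h1.mfderiv_eq (I := 𝓡 n) (I' := 𝓡 n)
  have h3 : MDifferentiableAt (𝓡 n) (𝓡 n) (transition x y : 𝔼 → 𝔼) z :=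
    (differentiableAt_transition hz hy).mdifferentiableAt
  rw [mfderiv_comp z (mdifferentiableAt_symm ((extChartAt (𝓡 n) y).map_source hy)) h3,
    mfderiv_eq_fderiv] at h2
  exact DFunLike.congr_fun h2 u

theorem localMetric_transition (g : PseudoRiemannianMetric n M) {x y : M} {z : 𝔼}
    (hz : z ∈ (extChartAt (𝓡 n) x).target)
    (hy : (extChartAt (𝓡 n) x).symm z ∈ (extChartAt (𝓡 n) y).source) (u v : 𝔼) :
    g.localMetric x z u v = g.localMetric y (transition x y z)
      (fderiv ℝ (transition x y) z u) (fderiv ℝ (transition x y) z v) := by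
  have h1 : (extChartAt (𝓡 n) y).symm (transition x y z) = (extChartAt (𝓡 n) x).symm z :=
    (extChartAt (𝓡 n) y).left_inv hy
  have h2 (p q : M) (h : p = q) (a b : 𝔼) : g.inner p a b = g.inner q a b := by rw [h]
  rw [localMetric_apply, localMetric_apply]
  refine (h2 _ _ h1.symm _ _).trans ?_
  rw [chartFrame_eq_comp hz hy u, chartFrame_eq_comp hz hy v]

/-- The Gram determinant changes by the square of the Jacobian determinant, so its root changes by
the absolute value, which is the factor in the change of variables formula. -/
theorem chartDensity_transition (g : PseudoRiemannianMetric n M) {x y : M} {z : 𝔼}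
    (hz : z ∈ (extChartAt (𝓡 n) x).target)
    (hy : (extChartAt (𝓡 n) x).symm z ∈ (extChartAt (𝓡 n) y).source) :
    g.chartDensity x z =
      |(fderiv ℝ (transition x y) z).det| * g.chartDensity y (transition x y z) := by
  rw [chartDensity_eq, chartDensity_eq, ← Real.sqrt_sq_eq_abs (fderiv ℝ (transition x y) z).det,
    ← Real.sqrt_mul (sq_nonneg _), ← abs_of_nonneg (sq_nonneg (fderiv ℝ (transition x y) z).det), ← abs_mul]
  congr 2
  set b := (EuclideanSpace.basisFun (Fin n) ℝ).toBasis
  set L := fderiv ℝ (transition x y : 𝔼 → 𝔼) z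
  let B : LinearMap.BilinForm ℝ 𝔼 :=
    LinearMap.mk₂ ℝ (fun v w ↦ g.localMetric y (transition x y z) v w)
      (fun _ _ _ ↦ by rw [map_add, add_apply]) (fun _ _ _ ↦ by rw [map_smul, smul_apply])
      (fun _ _ _ ↦ by rw [map_add]) (fun _ _ _ ↦ by rw [map_smul])
  have h1 := LinearMap.BilinForm.toMatrix_comp b b B L.toLinearMap L.toLinearMap
  have h2 := congrArg Matrix.det h1
  rw [Matrix.det_mul, Matrix.det_mul, Matrix.det_transpose, LinearMap.det_toMatrix] at h2
  have h3 : GradientData.gramDet (g.localMetric x) b z =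
      (LinearMap.BilinForm.toMatrix b (B.comp L.toLinearMap L.toLinearMap)).det := by
    rw [GradientData.gramDet]
    congr 1
    ext i j
    rw [LinearMap.BilinForm.toMatrix_apply, Matrix.of_apply]
    exact g.localMetric_transition hz hy (b i) (b j)
  rw [h3, h2, ContinuousLinearMap.det]
  have h4 : (LinearMap.BilinForm.toMatrix b B).det =
      GradientData.gramDet (g.localMetric y) b (transition x y z) := by
    rw [GradientData.gramDet]
    congr 1
    ext i j
    rw [LinearMap.BilinForm.toMatrix_apply, Matrix.of_apply]
    rfl
  rw [h4]
  ring

variable [MeasurableSpace M] [BorelSpace M]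

theorem aemeasurable_extChartAt_symm (x : M) :
    AEMeasurable (extChartAt (𝓡 n) x).symm (volume.restrict (extChartAt (𝓡 n) x).target) :=
  (continuousOn_extChartAt_symm x).aemeasurable (isOpen_target x).measurableSet

theorem measurableSet_target_inter_preimage (x : M) {A : Set M} (hA : MeasurableSet A) :
    MeasurableSet ((extChartAt (𝓡 n) x).target ∩ (extChartAt (𝓡 n) x).symm ⁻¹' A) := by
  have h1 := (continuousOn_extChartAt_symm (I := 𝓡 n) x).domRestrict.measurable hA
  have h2 := ((MeasurableEmbedding.subtype_coe
    (isOpen_target (n := n) x).measurableSet).measurableSet_image).2 h1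
  convert h2
  ext z
  simp [and_comm]

theorem chartVolume_apply (g : PseudoRiemannianMetric n M) (x : M) {A : Set M}
    (hA : MeasurableSet A) : g.chartVolume x A =
      ∫⁻ z in (extChartAt (𝓡 n) x).target ∩ (extChartAt (𝓡 n) x).symm ⁻¹' A,
        ENNReal.ofReal (g.chartDensity x z) := by
  rw [chartVolume, Measure.map_apply_of_aemeasurable
    ((aemeasurable_extChartAt_symm x).mono_ac (withDensity_absolutelyContinuous _ _)) hA,
    withDensity_apply', Measure.restrict_restrict' (isOpen_target x).measurableSet,
    Set.inter_comm]

theorem chartVolume_compl_source (g : PseudoRiemannianMetric n M) (x : M) :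
    g.chartVolume x (extChartAt (𝓡 n) x).sourceᶜ = 0 := by
  rw [chartVolume_apply _ _ (isOpen_extChartAt_source x).measurableSet.compl]
  have h1 : (extChartAt (𝓡 n) x).target ∩
      (extChartAt (𝓡 n) x).symm ⁻¹' (extChartAt (𝓡 n) x).sourceᶜ = ∅ :=
    Set.eq_empty_of_forall_notMem fun z hz ↦ hz.2 ((extChartAt (𝓡 n) x).map_target hz.1)
  rw [h1, Measure.restrict_empty, lintegral_zero_measure]

/-- The measures `chartVolume` agree on overlaps of charts. -/
theorem chartVolume_eq_of_subset (g : PseudoRiemannianMetric n M) {x y : M} {A : Set M}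
    (hA : MeasurableSet A) (hx : A ⊆ (extChartAt (𝓡 n) x).source)
    (hy : A ⊆ (extChartAt (𝓡 n) y).source) : g.chartVolume x A = g.chartVolume y A := by
  rw [chartVolume_apply _ _ hA, chartVolume_apply _ _ hA]
  set S := (extChartAt (𝓡 n) x).target ∩ (extChartAt (𝓡 n) x).symm ⁻¹' A with hS
  have h1 : (extChartAt (𝓡 n) y).target ∩ (extChartAt (𝓡 n) y).symm ⁻¹' A =
      transition x y '' S := by
    ext w
    constructor
    · rintro ⟨hw, hw'⟩
      refine ⟨extChartAt (𝓡 n) x ((extChartAt (𝓡 n) y).symm w),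
        ⟨(extChartAt (𝓡 n) x).map_source (hx hw'), ?_⟩, ?_⟩
      · rwa [Set.mem_preimage, (extChartAt (𝓡 n) x).left_inv (hx hw')]
      · rw [transition, Function.comp_apply, (extChartAt (𝓡 n) x).left_inv (hx hw'),
          (extChartAt (𝓡 n) y).right_inv hw]
    · rintro ⟨z, ⟨hz, hz'⟩, rfl⟩
      refine ⟨(extChartAt (𝓡 n) y).map_source (hy hz'), ?_⟩
      rwa [Set.mem_preimage, transition, Function.comp_apply,
        (extChartAt (𝓡 n) y).left_inv (hy hz')]
  have h2 : Set.InjOn (transition x y : 𝔼 → 𝔼) S := fun z hz w hw h ↦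
    (extChartAt (𝓡 n) x).symm.injOn hz.1 hw.1
      ((extChartAt (𝓡 n) y).injOn (hy hz.2) (hy hw.2) h)
  rw [h1, lintegral_image_eq_lintegral_abs_det_fderiv_mul volume
    (measurableSet_target_inter_preimage x hA) (fun z hz ↦
      (differentiableAt_transition hz.1 (hy hz.2)).hasFDerivAt.hasFDerivWithinAt) h2]
  refine setLIntegral_congr_fun (measurableSet_target_inter_preimage x hA) fun z hz ↦ ?_
  rw [g.chartDensity_transition hz.1 (hy hz.2), ENNReal.ofReal_mul (abs_nonneg _)]

/-- To bound the supremum it suffices to find one measure above every `chartVolume y`. The part of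
`chartVolume y` inside the chart at `x` is at most `chartVolume x`, because the two agree on the
overlap; the part outside is at most the restriction of `μ_g` to the complement. -/
theorem volumeMeasure_restrict_source (g : PseudoRiemannianMetric n M) (x : M) :
    g.volumeMeasure.restrict (extChartAt (𝓡 n) x).source = g.chartVolume x := by
  have hm (y : M) := (isOpen_extChartAt_source (I := 𝓡 n) y).measurableSet
  have hcv (y : M) : (g.chartVolume y).restrict (extChartAt (𝓡 n) y).source = g.chartVolume y :=
    Measure.restrict_eq_self_of_ae_mem (g.chartVolume_compl_source y)
  have h1 : g.volumeMeasure ≤ g.chartVolume x +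
      g.volumeMeasure.restrict (extChartAt (𝓡 n) x).sourceᶜ := by
    refine iSup_le fun y ↦ ?_
    rw [← Measure.restrict_add_restrict_compl (μ := g.chartVolume y) (hm x)]
    refine add_le_add (Measure.le_iff.2 fun A hA ↦ ?_)
      (Measure.restrict_mono_measure (le_iSup g.chartVolume y) _)
    rw [← hcv y, Measure.restrict_restrict (hm x), Measure.restrict_apply hA,
      g.chartVolume_eq_of_subset (x := y) (y := x) (hA.inter ((hm x).inter (hm y)))
        (fun _ h ↦ h.2.2) (fun _ h ↦ h.2.1)]
    exact measure_mono Set.inter_subset_left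
  refine le_antisymm ?_ ?_
  · refine (Measure.restrict_mono_measure h1 _).trans ?_
    rw [Measure.restrict_add, Measure.restrict_restrict (hm x), Set.inter_compl_self,
      Measure.restrict_empty, add_zero]
    exact Measure.restrict_le_self
  · rw [← hcv x]
    exact Measure.restrict_mono_measure (le_iSup g.chartVolume x) _

/-- The density is continuous, hence bounded near the centre of a chart, and balls have finite
Lebesgue measure. On a compact manifold this makes the total volume finite. -/
instance isLocallyFiniteMeasure_volumeMeasure (g : PseudoRiemannianMetric n M) :
    IsLocallyFiniteMeasure g.volumeMeasure where
  finiteAtNhds x := by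
    have hz := mem_extChartAt_target (I := 𝓡 n) x
    have h1 := (g.hasFDerivAt_chartDensity hz).continuousAt
    set C := g.chartDensity x (extChartAt (𝓡 n) x x) + 1
    have h2 : {z | g.chartDensity x z < C} ∩ Metric.ball (extChartAt (𝓡 n) x x) 1 ∈
        𝓝 (extChartAt (𝓡 n) x x) :=
      Filter.inter_mem (h1.eventually_lt continuousAt_const (lt_add_one _))
        (Metric.ball_mem_nhds _ one_pos)
    obtain ⟨U, hU, hUo, hxU⟩ := mem_nhds_iff.1 h2
    set A := (extChartAt (𝓡 n) x).source ∩ extChartAt (𝓡 n) x ⁻¹' U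
    have hA : IsOpen A := (continuousOn_extChartAt x).isOpen_inter_preimage
      (isOpen_extChartAt_source x) hUo
    refine ⟨A, hA.mem_nhds ⟨mem_extChartAt_source x, hxU⟩, ?_⟩
    have h3 : g.volumeMeasure A = g.chartVolume x A := by
      rw [← g.volumeMeasure_restrict_source x, Measure.restrict_apply hA.measurableSet,
        Set.inter_eq_left.2 fun _ h ↦ h.1]
    have h4 : (extChartAt (𝓡 n) x).target ∩ (extChartAt (𝓡 n) x).symm ⁻¹' A ⊆ U := by
      rintro z ⟨hz, hz'⟩
      have := hz'.2
      rwa [Set.mem_preimage, (extChartAt (𝓡 n) x).right_inv hz] at this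
    rw [h3, chartVolume_apply _ _ hA.measurableSet]
    calc _ ≤ ∫⁻ z in U, ENNReal.ofReal (g.chartDensity x z) := lintegral_mono_set h4
      _ ≤ ∫⁻ z in U, ENNReal.ofReal C := setLIntegral_mono' hUo.measurableSet fun z hz ↦
          ENNReal.ofReal_le_ofReal (hU hz).1.le
      _ < ⊤ := by
        rw [setLIntegral_const]
        exact ENNReal.mul_lt_top ENNReal.ofReal_lt_top
          ((measure_mono (hU.trans Set.inter_subset_right)).trans_lt measure_ball_lt_top)

theorem integral_volumeMeasure_of_support_subset (g : PseudoRiemannianMetric n M) {x : M}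
    {h : M → ℝ} (hc : Continuous h) (hh : Function.support h ⊆ (extChartAt (𝓡 n) x).source) :
    ∫ y, h y ∂g.volumeMeasure = ∫ z in (extChartAt (𝓡 n) x).target,
      g.chartDensity x z * h ((extChartAt (𝓡 n) x).symm z) := by
  have hd : AEMeasurable (fun z ↦ ENNReal.ofReal (g.chartDensity x z))
      (volume.restrict (extChartAt (𝓡 n) x).target) :=
    ((g.continuousOn_chartDensity x).aemeasurable (isOpen_target x).measurableSet).ennreal_ofReal
  rw [← setIntegral_eq_integral_of_forall_compl_eq_zero
    (s := (extChartAt (𝓡 n) x).source) fun y hy ↦ by_contra fun h ↦ hy (hh h),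
    volumeMeasure_restrict_source, chartVolume, integral_map
      ((aemeasurable_extChartAt_symm x).mono_ac (withDensity_absolutelyContinuous _ _))
      hc.aestronglyMeasurable,
    integral_withDensity_eq_integral_toReal_smul₀ hd (.of_forall fun _ ↦ ENNReal.ofReal_lt_top)]
  simp only [ENNReal.toReal_ofReal (g.chartDensity_nonneg x _), smul_eq_mul]

end PseudoRiemannianMetric
end

/-! ### The divergence theorem. -/

noncomputable section

namespace LocalGeometry

set_option maxSynthPendingDepth 3
set_option autoImplicit false
set_option linter.unusedSectionVars false

/-- The divergence theorem for compactly supported vector fields on a Euclidean space. -/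
theorem integral_traceCLM_fderiv_eq_zero {n : ℕ}
    {W : EuclideanSpace ℝ (Fin n) → EuclideanSpace ℝ (Fin n)} (hW : ContDiff ℝ 1 W)
    (hc : HasCompactSupport W) : ∫ z, traceCLM (fderiv ℝ W z) = 0 := by
  set b := EuclideanSpace.basisFun (Fin n) ℝ
  have hd : Differentiable ℝ W := hW.differentiable (by simp)
  have hi (i : Fin n) : ContDiff ℝ 1 (fun z ↦ inner ℝ (b i) (W z)) := contDiff_const.inner ℝ hW
  have hci (i : Fin n) : HasCompactSupport (fun z ↦ inner ℝ (b i) (W z)) :=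
    hc.comp_left (g := fun w ↦ inner ℝ (b i) w) (by simp)
  have h1 (z : EuclideanSpace ℝ (Fin n)) : traceCLM (fderiv ℝ W z) =
      ∑ i, fderiv ℝ (fun z ↦ inner ℝ (b i) (W z)) z (b i) := by
    rw [traceCLM_apply, LinearMap.trace_eq_sum_inner _ b]
    refine Finset.sum_congr rfl fun i _ ↦ ?_
    rw [fderiv_inner_apply ℝ (differentiableAt_const _) (hd z)]
    simp
  have h2 (i : Fin n) : Integrable fun z ↦ fderiv ℝ (fun z ↦ inner ℝ (b i) (W z)) z (b i) :=
    (((hi i).continuous_fderiv (by simp)).clm_apply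
      continuous_const).integrable_of_hasCompactSupport ((hci i).fderiv_apply ℝ (b i))
  simp_rw [h1]
  rw [integral_finsetSum _ fun i _ ↦ h2 i]
  refine Finset.sum_eq_zero fun i _ ↦ ?_
  -- Integration by parts against the constant 1, whose derivative vanishes.
  have h3 := integral_mul_fderiv_eq_neg_fderiv_mul_of_integrable (μ := volume)
    (f := fun _ ↦ (1 : ℝ)) (g := fun z ↦ inner ℝ (b i) (W z)) (v := b i) (by simp)
    (by simpa using h2 i)
    (by simpa using (hi i).continuous.integrable_of_hasCompactSupport (hci i))
    (fun _ _ ↦ differentiableAt_const _) (fun z _ ↦ (hi i).differentiable (by simp) z)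
  simpa using h3

theorem GradientData.contDiffOn_gramDet {E : Type*} [NormedAddCommGroup E] [NormedSpace ℝ E]
    [FiniteDimensional ℝ E] {ι : Type*} [Fintype ι] [DecidableEq ι] {s : Set E}
    {G : E → E →L[ℝ] E →L[ℝ] ℝ} {F : E → ℝ} {ξ : E → E} (h : GradientData s G F ξ)
    (b : Module.Basis ι ℝ E) : ContDiffOn ℝ ∞ (gramDet G b) s := by
  change ContDiffOn ℝ ∞ (fun z ↦ (Matrix.of fun i j ↦ G z (b i) (b j)).det) s
  simp only [Matrix.det_apply, Matrix.of_apply]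
  refine ContDiffOn.sum fun σ _ ↦ ContDiffOn.const_smul _ (contDiffOn_prod fun i _ ↦ ?_)
  exact (h.contDiffOn_metric.clm_apply contDiffOn_const).clm_apply contDiffOn_const

/-- The coordinate formula `div X = δ⁻¹ ∂_i(δ X^i)` for `X = a ξ`. It holds because `dδ(ξ) = δ tr
Γ(ξ)` and, by torsion-freeness, `Γ(ξ, ·)` and `Γ(·, ξ)` are the same endomorphism. -/
theorem GradientData.traceCLM_fderiv_smul_grad {E : Type*} [NormedAddCommGroup E] [NormedSpace ℝ E]
    [FiniteDimensional ℝ E] {s : Set E} {G : E → E →L[ℝ] E →L[ℝ] ℝ} {F : E → ℝ} {ξ : E → E}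
    (h : GradientData s G F ξ) {z : E} (hz : z ∈ s) {a δ : E → ℝ} (ha : DifferentiableAt ℝ a z)
    (hδ : HasFDerivAt δ (δ z • (traceCLM ∘L christoffel G z)) z) :
    traceCLM (fderiv ℝ (fun y ↦ (a y * δ y) • ξ y) z) =
      δ z * (a z * traceCLM (covDeriv (christoffel G) ξ z) + fderiv ℝ a z (ξ z)) := by
  have h1 : HasFDerivAt (fun y ↦ a y * δ y)
      (a z • (δ z • (traceCLM ∘L christoffel G z)) + δ z • fderiv ℝ a z) z :=
    HasFDerivAt.fun_mul ha.hasFDerivAt hδ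
  have h2 : (christoffel G z).flip (ξ z) = christoffel G z (ξ z) := by
    ext1 u
    rw [ContinuousLinearMap.flip_apply, christoffel_symm G (h.fderiv_symm hz)]
  rw [fderiv_fun_smul h1.differentiableAt (h.differentiableAt_grad hz), h1.fderiv, covDeriv, h2,
    map_add, map_add, map_smul, traceCLM_smulRight]
  simp only [add_apply, smul_apply, smul_eq_mul, ContinuousLinearMap.comp_apply]
  ring

end LocalGeometry

namespace PseudoRiemannianMetric

set_option maxSynthPendingDepth 3
set_option autoImplicit false
set_option linter.unusedSectionVars false

open LocalGeometry

variable {n : ℕ} {M : Type*} [TopologicalSpace M] [ChartedSpace (EuclideanSpace ℝ (Fin n)) M]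
  [IsManifold (𝓡 n) ∞ M]

local notation "𝔼" => EuclideanSpace ℝ (Fin n)

theorem contDiffOn_chartDensity (g : PseudoRiemannianMetric n M) (x : M) :
    ContDiffOn ℝ ∞ (g.chartDensity x) (extChartAt (𝓡 n) x).target := by
  have h := g.gradientData (f := fun _ ↦ 0) contMDiff_const x
  have h1 (z) (hz : z ∈ (extChartAt (𝓡 n) x).target) :=
    h.gramDet_ne_zero (EuclideanSpace.basisFun (Fin n) ℝ).toBasis hz
  refine ((ContDiffOn.abs (h.contDiffOn_gramDet _) h1).sqrt
    fun z hz ↦ abs_ne_zero.2 (h1 z hz)).congr fun z _ ↦ g.chartDensity_eq x z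

variable [T2Space M] [CompactSpace M] [MeasurableSpace M] [BorelSpace M]

/-- The divergence theorem for `ρ grad f`, with `ρ` supported in the domain of a chart. -/
theorem integral_divergence_eq_zero_of_tsupport_subset (g : PseudoRiemannianMetric n M) {f : M → ℝ}
    (hf : ContMDiff (𝓡 n) 𝓘(ℝ, ℝ) ∞ f) {ρ : M → ℝ} (hρ : ContMDiff (𝓡 n) 𝓘(ℝ, ℝ) ∞ ρ) {x : M}
    (hs : tsupport ρ ⊆ (extChartAt (𝓡 n) x).source) :
    ∫ y, (ρ y * g.laplacian g.leviCivita f y + mvfderiv (𝓡 n) ρ y (g.grad f y))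
      ∂g.volumeMeasure = 0 := by
  set φ := extChartAt (𝓡 n) x
  have hd := g.gradientData hf x
  set ξ := localField x (g.grad f)
  -- The coordinate field `ρ δ ξ`, extended by zero outside the chart. The extension is smooth
  -- because it vanishes off the compact set `K`, which lies inside the target.
  set W : 𝔼 → 𝔼 := φ.target.indicator fun z ↦ (ρ (φ.symm z) * g.chartDensity x z) • ξ z with hW
  set K := φ '' tsupport ρ
  have hK : IsCompact K :=
    (isClosed_tsupport ρ).isCompact.image_of_continuousOn ((continuousOn_extChartAt x).mono hs)
  have hKΩ : K ⊆ φ.target := by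
    rintro _ ⟨y, hy, rfl⟩
    exact φ.map_source (hs hy)
  have hsupp : Function.support W ⊆ K := by
    intro z hz
    by_cases h : z ∈ φ.target
    · refine ⟨φ.symm z, subset_tsupport ρ fun h0 ↦ hz ?_, φ.right_inv h⟩
      rw [hW, Set.indicator_of_mem h, h0, zero_mul, zero_smul]
    · exact absurd (Set.indicator_of_notMem h _) hz
  have hcs : HasCompactSupport W := HasCompactSupport.of_support_subset_isCompact hK hsupp
  have hWc : ContDiff ℝ 1 W := by
    rw [contDiff_iff_contDiffAt]
    intro z
    by_cases h : z ∈ φ.target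
    · have h1 : ContDiffAt ℝ ∞ (fun z ↦ (ρ (φ.symm z) * g.chartDensity x z) • ξ z) z :=
        (((contDiffOn_comp_symm hρ x).mul (g.contDiffOn_chartDensity x)).smul
          hd.contDiffOn_grad).contDiffAt ((isOpen_target x).mem_nhds h)
      refine (h1.of_le (by norm_cast)).congr_of_eventuallyEq ?_
      filter_upwards [(isOpen_target x).mem_nhds h] with w hw using Set.indicator_of_mem hw _
    · refine (contDiffAt_const (c := (0 : 𝔼))).congr_of_eventuallyEq ?_
      filter_upwards [hK.isClosed.isOpen_compl.mem_nhds fun hz ↦ h (hKΩ hz)] with w hw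
      exact by_contra fun h0 ↦ hw (hsupp h0)
  have htr (z : 𝔼) (hz : z ∈ φ.target) : traceCLM (fderiv ℝ W z) = g.chartDensity x z *
      (ρ (φ.symm z) * g.laplacian g.leviCivita f (φ.symm z) +
        mvfderiv (𝓡 n) ρ (φ.symm z) (g.grad f (φ.symm z))) := by
    have h1 : W =ᶠ[𝓝 z] fun z ↦ (ρ (φ.symm z) * g.chartDensity x z) • ξ z := by
      filter_upwards [(isOpen_target x).mem_nhds hz] with w hw using Set.indicator_of_mem hw _
    have h2 : DifferentiableAt ℝ (ρ ∘ φ.symm) z :=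
      ((contDiffOn_comp_symm hρ x).contDiffAt ((isOpen_target x).mem_nhds hz)).differentiableAt
        (by simp)
    rw [h1.fderiv_eq, g.laplacian_symm hf (g.hasChristoffel_leviCivita x) hz,
      g.mvfderiv_grad_symm hf hρ hz]
    exact hd.traceCLM_fderiv_smul_grad hz h2 (g.hasFDerivAt_chartDensity hz)
  have hcont : Continuous fun y ↦ ρ y * g.laplacian g.leviCivita f y +
      mvfderiv (𝓡 n) ρ y (g.grad f y) :=
    (hρ.continuous.mul (g.contMDiff_laplacian_leviCivita hf).continuous).add
      (g.contMDiff_mvfderiv_grad hf hρ).continuous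
  have hsub : Function.support (fun y ↦ ρ y * g.laplacian g.leviCivita f y +
      mvfderiv (𝓡 n) ρ y (g.grad f y)) ⊆ φ.source := by
    intro y hy
    by_contra h
    have h1 : ρ =ᶠ[𝓝 y] fun _ ↦ (0 : ℝ) :=
      notMem_tsupport_iff_eventuallyEq.1 fun h' ↦ h (hs h')
    refine hy ?_
    have h2 : mvfderiv (𝓡 n) ρ y = 0 := by
      rw [mvfderiv, h1.mfderiv_eq, mfderiv_const]
      exact ContinuousLinearMap.comp_zero _
    simp only [h1.eq_of_nhds, h2, zero_mul, zero_add]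
    rfl
  have hW0 (z : 𝔼) (hz : z ∉ φ.target) : traceCLM (fderiv ℝ W z) = 0 := by
    have h1 : W =ᶠ[𝓝 z] fun _ ↦ (0 : 𝔼) := by
      filter_upwards [hK.isClosed.isOpen_compl.mem_nhds fun h ↦ hz (hKΩ h)] with w hw
      exact by_contra fun h0 ↦ hw (hsupp h0)
    rw [h1.fderiv_eq, fderiv_fun_const]
    exact map_zero traceCLM
  rw [g.integral_volumeMeasure_of_support_subset hcont hsub]
  refine (setIntegral_congr_fun (isOpen_target x).measurableSet fun z hz ↦ (htr z hz).symm).trans ?_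
  rw [setIntegral_eq_integral_of_forall_compl_eq_zero hW0]
  exact integral_traceCLM_fderiv_eq_zero hWc hcs

theorem integrable_of_contMDiff (g : PseudoRiemannianMetric n M) {h : M → ℝ}
    (hh : ContMDiff (𝓡 n) 𝓘(ℝ, ℝ) ∞ h) : Integrable h g.volumeMeasure :=
  hh.continuous.integrable_of_hasCompactSupport (HasCompactSupport.of_compactSpace h)

/-- The integral of the Laplacian of a function on a closed manifold is zero. -/
theorem integral_laplacian_eq_zero (g : PseudoRiemannianMetric n M) {f : M → ℝ}
    (hf : ContMDiff (𝓡 n) 𝓘(ℝ, ℝ) ∞ f) :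
    ∫ y, g.laplacian g.leviCivita f y ∂g.volumeMeasure = 0 := by
  obtain ⟨p, hp⟩ := SmoothPartitionOfUnity.exists_isSubordinate_chartAt_source (𝓡 n) M
  have hfin := p.locallyFinite.finite_nonempty_of_compact
  -- The integrand is `div(ρ grad f)`, which is additive in `ρ`. Smoothness is part of `P` because
  -- additivity uses the differentiability and integrability of the summands. At the full sum `ρ =
  -- 1` only the Laplacian is left.
  let P (ρ : M → ℝ) : Prop := ContMDiff (𝓡 n) 𝓘(ℝ, ℝ) ∞ ρ ∧
    ∫ y, (ρ y * g.laplacian g.leviCivita f y + mvfderiv (𝓡 n) ρ y (g.grad f y))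
      ∂g.volumeMeasure = 0
  have hint {ρ : M → ℝ} (hρ : ContMDiff (𝓡 n) 𝓘(ℝ, ℝ) ∞ ρ) : Integrable
      (fun y ↦ ρ y * g.laplacian g.leviCivita f y + mvfderiv (𝓡 n) ρ y (g.grad f y))
      g.volumeMeasure :=
    (g.integrable_of_contMDiff (hρ.mul (g.contMDiff_laplacian_leviCivita hf))).add
      (g.integrable_of_contMDiff (g.contMDiff_mvfderiv_grad hf hρ))
  have hsum : P (∑ i ∈ hfin.toFinset, fun y ↦ p i y) := by
    refine Finset.sum_induction _ P ?_ ⟨contMDiff_const, ?_⟩ fun i _ ↦ ⟨(p i).contMDiff, ?_⟩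
    · rintro a b ⟨ha, ha'⟩ ⟨hb, hb'⟩
      refine ⟨ha.add hb, ?_⟩
      rw [← add_zero (0 : ℝ)]
      nth_rewrite 1 [← ha']
      rw [← hb', ← integral_add (hint ha) (hint hb)]
      refine integral_congr_ae (.of_forall fun y ↦ ?_)
      simp only
      rw [mvfderiv_add ((ha y).mdifferentiableAt (by simp)) ((hb y).mdifferentiableAt (by simp)),
        Pi.add_apply, add_apply]
      ring
    · refine (integral_congr_ae (.of_forall fun y ↦ ?_)).trans (integral_zero M ℝ)
      have : mvfderiv (𝓡 n) (0 : M → ℝ) y = 0 := mvfderiv_const 0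
      simp only [this, Pi.zero_apply, zero_mul, zero_add]
      rfl
    · exact g.integral_divergence_eq_zero_of_tsupport_subset hf (p i).contMDiff (x := i)
        (by simpa using hp i)
  have hone : (∑ i ∈ hfin.toFinset, fun y ↦ p i y) = fun _ ↦ (1 : ℝ) := by
    ext y
    rw [Finset.sum_apply, ← p.sum_eq_one (Set.mem_univ y)]
    refine (finsum_eq_sum_of_support_subset _ fun i hi ↦ ?_).symm
    rw [Set.Finite.coe_toFinset]
    exact ⟨y, hi⟩
  rw [hone] at hsum
  rw [← hsum.2]
  refine integral_congr_ae (.of_forall fun y ↦ ?_)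
  simp only [mvfderiv_const, one_mul]
  exact (add_zero _).symm

end PseudoRiemannianMetric
end

/-! ### Integration of the pointwise identities. -/

theorem mainTheorem9 (n : ℕ) (M : Type*) [TopologicalSpace M] [T2Space M] [CompactSpace M]
    [ChartedSpace (EuclideanSpace ℝ (Fin n)) M] [IsManifold (𝓡 n) ∞ M]
    [MeasurableSpace M] [BorelSpace M]
    (g : PseudoRiemannianMetric n M)
    (f : M → ℝ) (hf : ContMDiff (𝓡 n) 𝓘(ℝ, ℝ) ∞ f)
    (c : ℝ) (hc : ∀ x, g.inner x (g.grad f x) (g.grad f x) = c) :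
    -- the volume is finite and the integrands are integrable
    g.volumeMeasure Set.univ < ⊤ ∧
    Integrable (fun x ↦ g.innerTensor x (g.hess g.leviCivita f x) (g.hess g.leviCivita f x))
      g.volumeMeasure ∧
    Integrable (fun x ↦ mvfderiv (𝓡 n) (g.laplacian g.leviCivita f) x (g.grad f x))
      g.volumeMeasure ∧
    Integrable (fun x ↦ g.innerTensor x (PseudoRiemannianMetric.ricci (g.dfConnection f) x)
      (fun u v ↦ mvfderiv (𝓡 n) f x u * mvfderiv (𝓡 n) f x v)) g.volumeMeasure ∧
    Integrable (fun x ↦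
      g.innerTensor x (g.hess (g.dfConnection f) f x) (g.hess (g.dfConnection f) f x))
      g.volumeMeasure ∧
    Integrable (fun x ↦ mvfderiv (𝓡 n) (g.laplacian (g.dfConnection f) f) x (g.grad f x))
      g.volumeMeasure ∧
    Integrable (fun x ↦
      PseudoRiemannianMetric.ricci (g.dfConnection f) x (g.grad f x) (g.grad f x))
      g.volumeMeasure ∧
    -- the volume formula in terms of `Hess^g`, `Δ^g` and `Ric^{df}`, with denominators cleared
    2 * ((n : ℝ) - 1) * c ^ 2 * (g.volumeMeasure Set.univ).toReal =
      (∫ x, g.innerTensor x (g.hess g.leviCivita f x) (g.hess g.leviCivita f x)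
        ∂g.volumeMeasure) +
      (∫ x, mvfderiv (𝓡 n) (g.laplacian g.leviCivita f) x (g.grad f x) ∂g.volumeMeasure) +
      (∫ x, g.innerTensor x (PseudoRiemannianMetric.ricci (g.dfConnection f) x)
        (fun u v ↦ mvfderiv (𝓡 n) f x u * mvfderiv (𝓡 n) f x v) ∂g.volumeMeasure) ∧
    -- the same, solved for the volume
    (n ≠ 1 → c ≠ 0 → (g.volumeMeasure Set.univ).toReal = 1 / (2 * ((n : ℝ) - 1) * c ^ 2) *
      ((∫ x, g.innerTensor x (g.hess g.leviCivita f x) (g.hess g.leviCivita f x)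
        ∂g.volumeMeasure) +
      (∫ x, mvfderiv (𝓡 n) (g.laplacian g.leviCivita f) x (g.grad f x) ∂g.volumeMeasure) +
      (∫ x, g.innerTensor x (PseudoRiemannianMetric.ricci (g.dfConnection f) x)
        (fun u v ↦ mvfderiv (𝓡 n) f x u * mvfderiv (𝓡 n) f x v) ∂g.volumeMeasure))) ∧
    -- the volume formula in terms of `Hess^{df}`, `Δ^{df}` and `Ric^{df}`, denominators cleared
    3 * ((n : ℝ) + 2) * c ^ 2 * (g.volumeMeasure Set.univ).toReal =
      (∫ x, g.innerTensor x (g.hess (g.dfConnection f) f x) (g.hess (g.dfConnection f) f x)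
        ∂g.volumeMeasure) +
      (∫ x, mvfderiv (𝓡 n) (g.laplacian (g.dfConnection f) f) x (g.grad f x)
        ∂g.volumeMeasure) +
      (∫ x, PseudoRiemannianMetric.ricci (g.dfConnection f) x (g.grad f x) (g.grad f x)
        ∂g.volumeMeasure) ∧
    -- the same, solved for the volume
    (c ≠ 0 → (g.volumeMeasure Set.univ).toReal = 1 / (3 * ((n : ℝ) + 2) * c ^ 2) *
      ((∫ x, g.innerTensor x (g.hess (g.dfConnection f) f x) (g.hess (g.dfConnection f) f x)
        ∂g.volumeMeasure) +
      (∫ x, mvfderiv (𝓡 n) (g.laplacian (g.dfConnection f) f) x (g.grad f x)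
        ∂g.volumeMeasure) +
      (∫ x, PseudoRiemannianMetric.ricci (g.dfConnection f) x (g.grad f x) (g.grad f x)
        ∂g.volumeMeasure))) := by
  have hΔ := g.contMDiff_laplacian_leviCivita hf
  have hi := g.integrable_of_contMDiff hΔ
  have hμ : IsFiniteMeasure g.volumeMeasure := inferInstance
  -- The Laplacian integrates to zero, so only the constant term of the pointwise identities
  -- contributes.
  have hvol (a b : ℝ) : ∫ x, (a * g.laplacian g.leviCivita f x + b) ∂g.volumeMeasure =
      b * (g.volumeMeasure Set.univ).toReal := by
    rw [integral_add (hi.const_mul a) (integrable_const b), integral_const_mul,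
      g.integral_laplacian_eq_zero hf, integral_const, mul_zero, zero_add, smul_eq_mul, mul_comm]
    rfl
  have i1 : Integrable (fun x ↦
      g.innerTensor x (g.hess g.leviCivita f x) (g.hess g.leviCivita f x)) g.volumeMeasure := by
    simp only [g.innerTensor_hess_leviCivita hf]
    exact g.integrable_of_contMDiff (g.contMDiff_trace_comp hf g.hasChristoffel_leviCivita
      fun x ↦ (g.gradientData hf x).contDiffOn_christoffel)
  have i2 : Integrable (fun x ↦ mvfderiv (𝓡 n) (g.laplacian g.leviCivita f) x (g.grad f x))
      g.volumeMeasure := g.integrable_of_contMDiff (g.contMDiff_mvfderiv_grad hf hΔ)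
  have i4 : Integrable (fun x ↦
      g.innerTensor x (g.hess (g.dfConnection f) f x) (g.hess (g.dfConnection f) f x))
      g.volumeMeasure := by
    simp only [g.innerTensor_hess_dfConnection hf]
    exact g.integrable_of_contMDiff (g.contMDiff_trace_comp hf (g.hasChristoffel_dfConnection hf)
      fun x ↦ (g.gradientData hf x).contDiffOn_dfChristoffel)
  have i5 : Integrable (fun x ↦
      mvfderiv (𝓡 n) (g.laplacian (g.dfConnection f) f) x (g.grad f x)) g.volumeMeasure :=
    g.integrable_of_contMDiff
      (g.contMDiff_mvfderiv_grad hf (g.contMDiff_laplacian_dfConnection hf))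
  have i6 : Integrable (fun x ↦
      PseudoRiemannianMetric.ricci (g.dfConnection f) x (g.grad f x) (g.grad f x))
      g.volumeMeasure := by
    -- The Bochner formula expresses the Ricci term through functions already known to be
    -- integrable.
    simp only [g.ricci_dfConnection_grad hf hc]
    exact (((g.integrable_of_contMDiff (g.contMDiff_laplacian_dfConnection hf)).const_mul _).sub
      i4).sub i5
  have i3 : Integrable (fun x ↦ g.innerTensor x (PseudoRiemannianMetric.ricci (g.dfConnection f) x)
      (fun u v ↦ mvfderiv (𝓡 n) f x u * mvfderiv (𝓡 n) f x v)) g.volumeMeasure := by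
    simp only [g.innerTensor_ricci_dfConnection hf]
    exact i6
  have first : 2 * ((n : ℝ) - 1) * c ^ 2 * (g.volumeMeasure Set.univ).toReal =
      (∫ x, g.innerTensor x (g.hess g.leviCivita f x) (g.hess g.leviCivita f x)
        ∂g.volumeMeasure) +
      (∫ x, mvfderiv (𝓡 n) (g.laplacian g.leviCivita f) x (g.grad f x) ∂g.volumeMeasure) +
      (∫ x, g.innerTensor x (PseudoRiemannianMetric.ricci (g.dfConnection f) x)
        (fun u v ↦ mvfderiv (𝓡 n) f x u * mvfderiv (𝓡 n) f x v) ∂g.volumeMeasure) := by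
    -- Turns the volume term into the integral of the right-hand side of
    -- `hess_leviCivita_add_ricci`, here with `a = c`; the second formula takes `a = 3c`.
    rw [← hvol c, ← integral_add i1 i2]
    exact (integral_congr_ae (.of_forall fun x ↦ (g.hess_leviCivita_add_ricci hf hc x).symm)).trans
      (integral_add (i1.add i2) i3)
  have second : 3 * ((n : ℝ) + 2) * c ^ 2 * (g.volumeMeasure Set.univ).toReal =
      (∫ x, g.innerTensor x (g.hess (g.dfConnection f) f x) (g.hess (g.dfConnection f) f x)
        ∂g.volumeMeasure) +
      (∫ x, mvfderiv (𝓡 n) (g.laplacian (g.dfConnection f) f) x (g.grad f x)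
        ∂g.volumeMeasure) +
      (∫ x, PseudoRiemannianMetric.ricci (g.dfConnection f) x (g.grad f x) (g.grad f x)
        ∂g.volumeMeasure) := by
    rw [← hvol (3 * c), ← integral_add i4 i5]
    exact (integral_congr_ae (.of_forall fun x ↦ (g.hess_dfConnection_add_ricci hf hc x).symm)).trans
      (integral_add (i4.add i5) i6)
  refine ⟨measure_lt_top _ _, i1, i2, i3, i4, i5, i6, first, fun hn hc0 ↦ ?_, second, fun hc0 ↦ ?_⟩
  · have : (n : ℝ) - 1 ≠ 0 := sub_ne_zero.2 (by exact_mod_cast hn)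
    rw [← first, one_div, inv_mul_cancel_left₀ (by positivity)]
  · rw [← second, one_div, inv_mul_cancel_left₀ (by positivity)]
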